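/- Let $k$ be a field, $R=k[x_0,\dots,x_n]$, and let $\prec$ be a term order on the monomials of $R$. Call $\prec$ reliable if for every monomial $\mathbf m$ the set of monomials $\mathbf n\prec\mathbf m$ is finite. Strata. The tail of a monomial $X^\alpha$ is $\{X^\beta : X^\beta\prec X^\alpha\}$ and its homogeneous tail is the set of those $X^\beta$ in the tail with $|\beta|=|\alpha|$. Let $J\subseteq R$ be a monomial ideal with minimal monomial basis $X^{\alpha_1},\dots,X^{\alpha_s}$. For every $i$ and every $X^\beta\notin J$ in the homogeneous tail of $X^{\alpha_i}$ introduce a variable $c_{i\beta}$, let $C$ be the (finite) set of these variables, and put $F_i=X^{\alpha_i}+\sum_\beta c_{i\beta}X^\beta\in k[C][X]$. For $i<j$ let $H_{ij}$ be a complete reduction with respect to $F_1,\dots,F_s$ (whose leading monomials are the $X^{\alpha_i}$) of the $S$-polynomial of $F_i$ and $F_j$; so no monomial in $X$ occurring in $H_{ij}$ lies in $J$. The homogeneous stratum $\mathcal{S}t_h(J,\prec)$ is the closed subscheme of $\operatorname{Spec} k[C]$ defined by the ideal generated by all the coefficients in $k[C]$ of the monomials in $X$ of the polynomials $H_{ij}$.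 If $\prec$ is reliable, the stratum $\mathcal{S}t(J,\prec)$ is defined in the same way with tails instead of homogeneous tails. The ideals $J(a_q,\dots,a_1)$. Let $q\le n$ and let $a_q,\dots,a_1$ be non-negative integers, not all zero. Let $s\ge 0$ be the minimal index with $a_{s+1}\ne0$. Then $J(a_q,\dots,a_1)\subseteq R$ is the ideal generated by the $q-s$ monomials $$x_{n-i}\prod_{j=i}^{q}x_{n-j}^{a_j}\quad(s+2\le i\le q)\qquad\text{and}\qquad \prod_{j=s+1}^{q}x_{n-j}^{a_j}.$$ Statement. For every term order $\prec$ on $R$, every $q\le n$ and every sequence $a_q,\dots,a_1$ of non-negative integers that are not all zero, the homogeneous stratum $\mathcal{S}t_h(J(a_q,\dots,a_1),\prec)$ is isomorphic, as a $k$-scheme, to an affine space $\mathbb A^d_k$ for some $d\ge 0$, whichever complete reductions $H_{ij}$ are used. If $\prec$ is reliable, the same holds for the stratum $\mathcal{S}t(J(a_q,\dots,a_1),\prec)$. In particular, both assertions hold, for the same $\prec$, for every saturated $\mathrm{Lex}$-segment ideal $J$ of $R$, that is, every monomial ideal $J$ that is saturated with respect to $(x_0,\dots,x_n)$ and contains,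 with any monomial, all monomials of the same degree that are higher in the lexicographic order with $x_0\succ x_1\succ\dots\succ x_n$ (the order $\prec$ itself need not be this one). -/

import Mathlib

namespace Strata

open MvPolynomial AlgebraicGeometry CategoryTheory

universe u v w

section MonomialIdeals

variable {σ : Type v} {k : Type u} [Field k]

/-- The set of (exponents of) monomials `X^α` lying in the ideal `J` of `k[X]`. -/
def monomialsIn (J : Ideal (MvPolynomial σ k)) : Set (σ →₀ ℕ) :=
  {α | monomial α (1 : k) ∈ J}

/-- `J` is generated by monomials. -/
def IsMonomialIdeal (J : Ideal (MvPolynomial σ k)) : Prop :=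
  ∃ S : Set (σ →₀ ℕ), J = Ideal.span ((fun α => monomial α (1 : k)) '' S)

/-- The monomial basis `B_J` of a monomial ideal `J`: the (exponents of the) monomials of `J`
that are minimal with respect to divisibility. -/
def basis (J : Ideal (MvPolynomial σ k)) : Set (σ →₀ ℕ) :=
  {α | Minimal (· ∈ monomialsIn J) α}

end MonomialIdeals

section Tails

variable {σ : Type v} (m : MonomialOrder.{v, w} σ)

/-- The tail of `X^α`: all monomials `X^β` with `β ≺ α`. -/
def tail (α : σ →₀ ℕ) : Set (σ →₀ ℕ) :=
  {β | m.toSyn β < m.toSyn α}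

/-- The homogeneous tail of `X^α`: all monomials `X^β` with `β ≺ α` and `|β| = |α|`. -/
def htail (α : σ →₀ ℕ) : Set (σ →₀ ℕ) :=
  {β | m.toSyn β < m.toSyn α ∧ β.degree = α.degree}

/-- A term order is reliable if every monomial has a finite tail. -/
def Reliable : Prop :=
  ∀ α : σ →₀ ℕ, (tail m α).Finite

end Tails

noncomputable section

variable {σ : Type} {k : Type u} [Field k] (m : MonomialOrder.{0, w} σ)
  (J : Ideal (MvPolynomial σ k)) (T : (σ →₀ ℕ) → Set (σ →₀ ℕ))

/-! Throughout, `T` prescribes the tail used for each monomial: it is `tail m` for the stratum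
and `htail m` for the homogeneous stratum. -/

/-- The monomials of the tail of `X^α` that do not belong to `J`. -/
abbrev TailMod (α : σ →₀ ℕ) : Type :=
  {β : σ →₀ ℕ // β ∈ T α ∧ β ∉ monomialsIn J}

/-- The index set of the new variables `C = (c_{α,β})`, where `X^α` runs over the monomial basis
of `J` and `X^β` over the monomials in the tail of `X^α` that are not in `J`. -/
abbrev Param : Type :=
  Σ α : basis J, TailMod J T α.1

/-- The polynomial ring `k[C]`, that is, the coordinate ring of the affine space `𝔸^N`. -/
abbrev ParamRing : Type u :=
  MvPolynomial (Param J T) k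

/-- The polynomial `F_α = X^α + ∑ c_{α,β} X^β` of `k[C][X]`, the sum being over the monomials
`X^β` in the tail of `X^α` that are not in `J` (it is only used for finite tails). -/
def genericPoly (α : basis J) : MvPolynomial σ (ParamRing J T) :=
  monomial α.1 1 + ∑ᶠ β : TailMod J T α.1, monomial β.1 (X ⟨α, β⟩)

/-- The `S`-polynomial of `F_α` and `F_β`; their leading monomials are `X^α` and `X^β`,
with coefficient `1`, and `α ⊔ β` is the exponent of the least common multiple. -/
def sPoly (α β : basis J) : MvPolynomial σ (ParamRing J T) :=
  monomial (α.1 ⊔ β.1 - α.1) 1 * genericPoly J T α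
    - monomial (α.1 ⊔ β.1 - β.1) 1 * genericPoly J T β

/-- One step of reduction by the polynomials `F_α`: a nonzero term `a C^δ X^(γ+α)` of `f` is
cancelled by subtracting `a C^δ X^γ F_α`. -/
def ReductionStep (f g : MvPolynomial σ (ParamRing J T)) : Prop :=
  ∃ (α : basis J) (γ : σ →₀ ℕ) (δ : Param J T →₀ ℕ),
    coeff δ (coeff (γ + α.1) f) ≠ 0 ∧
      g = f - monomial γ (monomial δ (coeff δ (coeff (γ + α.1) f))) * genericPoly J T α

/-- `h` is a complete reduction of `f` by the polynomials `F_α`: it is obtained from `f` by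
finitely many reduction steps, and no monomial in `X` occurring in `h` belongs to `J`. -/
def IsCompleteReduction (f h : MvPolynomial σ (ParamRing J T)) : Prop :=
  Relation.ReflTransGen (ReductionStep J T) f h ∧ ∀ μ ∈ h.support, μ ∉ monomialsIn J

/-- `H` chooses, for each (unordered) pair of distinct elements of the basis of `J`, listed here
increasingly, a complete reduction of their `S`-polynomial. -/
def IsReductionFamily (H : basis J → basis J → MvPolynomial σ (ParamRing J T)) : Prop :=
  ∀ α β : basis J, m.toSyn α.1 < m.toSyn β.1 → IsCompleteReduction J T (sPoly J T α β) (H α β)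

/-- The ideal of `k[C]` generated by all the coefficients of the monomials in `X` that appear in
the chosen complete reductions `H α β` of the `S`-polynomials. -/
def stratumIdeal (H : basis J → basis J → MvPolynomial σ (ParamRing J T)) :
    Ideal (ParamRing J T) :=
  Ideal.span {c | ∃ α β : basis J, m.toSyn α.1 < m.toSyn β.1 ∧ ∃ μ : σ →₀ ℕ, c = coeff μ (H α β)}

/-- The closed subscheme of `𝔸^N = Spec k[C]` defined by `stratumIdeal`, as a `k`-scheme. -/
def stratum (H : basis J → basis J → MvPolynomial σ (ParamRing J T)) :
    Over (Spec (CommRingCat.of k)) :=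
  Over.mk (Spec.map (CommRingCat.ofHom
    (algebraMap k (ParamRing J T ⧸ stratumIdeal m J T H))))

variable (k) in
/-- The affine space `𝔸^d` over `k`, as a `k`-scheme. -/
def affineSpace (d : ℕ) : Over (Spec (CommRingCat.of k)) :=
  Over.mk (𝔸(ULift.{u} (Fin d); Spec (CommRingCat.of k)) ↘ Spec (CommRingCat.of k))

/-- The stratum built from the tails `T` is isomorphic to an affine space over `k`, whichever
complete reductions are used to build it. (Complete reductions exist:
see `exists_isReductionFamily`.) -/
def IsAffineStratum : Prop :=
  ∃ d : ℕ, ∀ H : basis J → basis J → MvPolynomial σ (ParamRing J T),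
    IsReductionFamily m J T H → Nonempty (stratum m J T H ≅ affineSpace k d)

/-- The stratum `St(J, ≺)` is isomorphic to an affine space. -/
def StratumIsAffineSpace : Prop :=
  IsAffineStratum m J (tail m)

/-- The homogeneous stratum `St_h(J, ≺)` is isomorphic to an affine space. -/
def HomogeneousStratumIsAffineSpace : Prop :=
  IsAffineStratum m J (htail m)

section Existence

variable {m J T}

theorem coeff_genericPoly_of_not_lt [DecidableEq σ] (hT : ∀ α, T α ⊆ tail m α) (α : basis J) {μ : σ →₀ ℕ}
    (hμ : ¬ m.toSyn μ < m.toSyn α.1) :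
    coeff μ (genericPoly J T α) = if α.1 = μ then 1 else 0 := by
  have key : coeff μ (∑ᶠ β : TailMod J T α.1,
      (monomial β.1 (X ⟨α, β⟩ : ParamRing J T))) = 0 := by
    refine finsum_induction (fun g : MvPolynomial σ (ParamRing J T) => coeff μ g = 0) ?_ ?_ ?_
    · simp
    · intro f g hf hg
      simp [hf, hg]
    · intro β
      rw [coeff_monomial, if_neg]
      rintro rfl
      exact hμ (hT _ β.2.1)
  rw [genericPoly, coeff_add, key, add_zero, coeff_monomial]

theorem mem_monomialsIn_of_le {μ ν : σ →₀ ℕ} (h : μ ∈ monomialsIn J) (hle : μ ≤ ν) :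
    ν ∈ monomialsIn J := by
  have : monomial ν (1 : k) = monomial (ν - μ) 1 * monomial μ 1 := by
    rw [monomial_mul, tsub_add_cancel_of_le hle, one_mul]
  change monomial ν (1 : k) ∈ J
  rw [this]
  exact J.mul_mem_left _ h

theorem exists_isCompleteReduction [Finite σ] (hT : ∀ α, T α ⊆ tail m α)
    (f : MvPolynomial σ (ParamRing J T)) : ∃ h, IsCompleteReduction J T f h := by
  classical
  suffices H : ∀ (d : m.syn) (c : ℕ) (f : MvPolynomial σ (ParamRing J T)),
      (∀ μ ∈ f.support, μ ∈ monomialsIn J → m.toSyn μ ≤ d) →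
      (coeff (m.toSyn.symm d) f).support.card ≤ c → ∃ h, IsCompleteReduction J T f h by
    obtain ⟨d, hd⟩ : ∃ d : m.syn, ∀ μ ∈ f.support, m.toSyn μ ≤ d :=
      ⟨f.support.sup m.toSyn, fun μ hμ => Finset.le_sup (f := m.toSyn) hμ⟩
    exact H d _ f (fun μ hμ _ => hd μ hμ) le_rfl
  intro d
  induction d using WellFoundedLT.induction with
  | ind d ihd =>
  intro c
  induction c with
  | zero =>
    intro f hf hc
    have hz : coeff (m.toSyn.symm d) f = 0 := by
      rw [← MvPolynomial.support_eq_empty, ← Finset.card_eq_zero]; omega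
    by_cases hne : (f.support.filter (· ∈ monomialsIn J)).Nonempty
    · obtain ⟨ν, hν, hmax⟩ := Finset.exists_max_image _ m.toSyn hne
      rw [Finset.mem_filter] at hν
      refine ihd (m.toSyn ν) (lt_of_le_of_ne (hf ν hν.1 hν.2) ?_) _ f ?_ le_rfl
      · rintro rfl
        rw [AddEquiv.symm_apply_apply] at hz
        exact (mem_support_iff.mp hν.1) hz
      · intro μ hμ hμJ
        exact hmax μ (Finset.mem_filter.mpr ⟨hμ, hμJ⟩)
    · refine ⟨f, Relation.ReflTransGen.refl, fun μ hμ hμJ => hne ⟨μ, ?_⟩⟩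
      exact Finset.mem_filter.mpr ⟨hμ, hμJ⟩
  | succ c ihc =>
    intro f hf hc
    by_cases hz : coeff (m.toSyn.symm d) f = 0
    · exact ihc f hf (by simp [hz])
    by_cases hdJ : m.toSyn.symm d ∈ monomialsIn J
    · obtain ⟨α, hαd, hα⟩ := exists_minimal_le_of_wellFoundedLT (· ∈ monomialsIn J) _ hdJ
      obtain ⟨δ, hδ⟩ := Finset.nonempty_iff_ne_empty.mpr
        (fun h => hz (MvPolynomial.support_eq_empty.mp h))
      set γ := m.toSyn.symm d - α with hγ
      have hγα : γ + α = m.toSyn.symm d := tsub_add_cancel_of_le hαd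
      have hd : m.toSyn (γ + α) = d := by rw [hγα]; simp
      set a := coeff δ (coeff (γ + α) f) with ha
      have ha0 : a ≠ 0 := by
        rw [ha, hγα]; exact mem_support_iff.mp hδ
      set F := genericPoly J T ⟨α, hα⟩ with hF
      set g := f - monomial γ (monomial δ a) * F with hg
      have hcoeff : ∀ μ, d ≤ m.toSyn μ →
          coeff μ g = coeff μ f - if γ + α = μ then monomial δ a else 0 := by
        intro μ hμ
        rw [hg, coeff_sub, coeff_monomial_mul']
        congr 1
        by_cases hle : γ ≤ μ
        · rw [if_pos hle, hF, coeff_genericPoly_of_not_lt hT]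
          · have : (α = μ - γ) ↔ (γ + α = μ) := by
              rw [eq_tsub_iff_add_eq_of_le hle, add_comm]
            simp [this]
          · intro hlt
            have h1 : m.toSyn γ + m.toSyn (μ - γ) < m.toSyn γ + m.toSyn α := by
              gcongr
            rw [← map_add, ← map_add, add_tsub_cancel_of_le hle, hd] at h1
            exact absurd hμ (not_le.mpr h1)
        · rw [if_neg hle, if_neg]
          rintro rfl
          exact hle le_self_add
      obtain ⟨h, hh⟩ := ihc g (by
        intro μ hμ hμJ
        by_contra hlt
        rw [not_le] at hlt
        have hne : γ + α ≠ μ := by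
          rintro rfl
          rw [hd] at hlt
          exact lt_irrefl _ hlt
        have := hcoeff μ hlt.le
        rw [if_neg hne, sub_zero] at this
        have hμf : μ ∈ f.support := by
          rw [mem_support_iff, ← this]; exact mem_support_iff.mp hμ
        exact absurd (hf μ hμf hμJ) (not_le.mpr hlt)) (by
        have h1 := hcoeff (m.toSyn.symm d) (by simp)
        rw [if_pos hγα] at h1
        have h2 : (coeff (m.toSyn.symm d) g).support ⊆
            (coeff (m.toSyn.symm d) f).support.erase δ := by
          intro ε hε
          rw [mem_support_iff, h1, coeff_sub, coeff_monomial] at hε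
          rw [Finset.mem_erase, mem_support_iff]
          by_cases he : δ = ε
          · subst he
            rw [if_pos rfl, ha, hγα, sub_self] at hε
            exact absurd rfl hε
          · rw [if_neg he, sub_zero] at hε
            exact ⟨Ne.symm he, hε⟩
        have h3 := Finset.card_le_card h2
        rw [Finset.card_erase_of_mem hδ] at h3
        omega)
      exact ⟨h, Relation.ReflTransGen.head ⟨⟨α, hα⟩, γ, δ, ha0, rfl⟩ hh.1, hh.2⟩
    · by_cases hne : (f.support.filter (· ∈ monomialsIn J)).Nonempty
      · obtain ⟨ν, hν, hmax⟩ := Finset.exists_max_image _ m.toSyn hne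
        rw [Finset.mem_filter] at hν
        refine ihd (m.toSyn ν) (lt_of_le_of_ne (hf ν hν.1 hν.2) ?_) _ f ?_ le_rfl
        · rintro rfl
          rw [AddEquiv.symm_apply_apply] at hdJ
          exact hdJ hν.2
        · intro μ hμ hμJ
          exact hmax μ (Finset.mem_filter.mpr ⟨hμ, hμJ⟩)
      · refine ⟨f, Relation.ReflTransGen.refl, fun μ hμ hμJ => hne ⟨μ, ?_⟩⟩
        exact Finset.mem_filter.mpr ⟨hμ, hμJ⟩

/-- Complete reductions of the `S`-polynomials exist. -/
theorem exists_isReductionFamily [Finite σ] (hT : ∀ α, T α ⊆ tail m α) :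
    ∃ H : basis J → basis J → MvPolynomial σ (ParamRing J T), IsReductionFamily m J T H := by
  choose H hH using fun f : MvPolynomial σ (ParamRing J T) => exists_isCompleteReduction hT f
  exact ⟨fun α β => H (sPoly J T α β), fun α β _ => hH _⟩

end Existence

section LexIdeals

variable (k) (n : ℕ)

/-- The variable `x_{n-j}` of `k[x_0, …, x_n]`. -/
def xBack (j : ℕ) : MvPolynomial (Fin (n + 1)) k :=
  X ⟨n - j, by omega⟩

/-- The monomial `∏_{j=i}^q x_{n-j}^{a_j}` of `k[x_0, …, x_n]`. -/
def tailProd (q : ℕ) (a : ℕ → ℕ) (i : ℕ) : MvPolynomial (Fin (n + 1)) k :=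
  ∏ j ∈ Finset.Icc i q, xBack k n j ^ a j

/-- The smallest `s ≥ 0` with `a_{s+1} ≠ 0`. -/
def firstIndex (a : ℕ → ℕ) : ℕ :=
  sInf {s | a (s + 1) ≠ 0}

/-- The ideal `J(a_q, …, a_1)` of `k[x_0, …, x_n]` (for `q ≤ n` and `a_1, …, a_q` not all zero;
only these values of `a` matter): it is generated by the `q - s` monomials
`x_{n-i} ∏_{j=i}^q x_{n-j}^{a_j}`, `s + 2 ≤ i ≤ q`, and `∏_{j=s+1}^q x_{n-j}^{a_j}`, where `s ≥ 0`
is the smallest index such that `a_{s+1} ≠ 0`. -/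
def lexIdeal (q : ℕ) (a : ℕ → ℕ) : Ideal (MvPolynomial (Fin (n + 1)) k) :=
  Ideal.span
    ({f | ∃ i, firstIndex a + 2 ≤ i ∧ i ≤ q ∧ f = xBack k n i * tailProd k n q a i} ∪
      {tailProd k n q a (firstIndex a + 1)})

variable {k n}

/-- `J` is saturated: if `f 𝔪^N ⊆ J` for some `N`, with `𝔪 = (x_0, …, x_n)`, then `f ∈ J`. -/
def IsSaturated (J : Ideal (MvPolynomial (Fin (n + 1)) k)) : Prop :=
  ∀ f : MvPolynomial (Fin (n + 1)) k,
    (∃ N : ℕ, ∀ g ∈ Ideal.span (Set.range (X : Fin (n + 1) → MvPolynomial (Fin (n + 1)) k)) ^ N,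
      g * f ∈ J) → f ∈ J

/-- `J` is a `Lex`-segment ideal, for `Lex` with `x_0 ≻ x_1 ≻ ⋯ ≻ x_n`: it is a monomial ideal
which with any monomial contains all the `Lex`-higher monomials of the same degree. -/
def IsLexSegment (J : Ideal (MvPolynomial (Fin (n + 1)) k)) : Prop :=
  IsMonomialIdeal J ∧ ∀ μ ν : Fin (n + 1) →₀ ℕ, μ.degree = ν.degree → toLex μ < toLex ν →
    μ ∈ monomialsIn J → ν ∈ monomialsIn J

end LexIdeals

end

end Strata

/-! ### Translation-invariant orders with finite tails -/

namespace Strata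

open MvPolynomial

/-! The stratum is recognised by its functor of points. A ring map `θ : k[C] → A` kills the stratum
ideal exactly when the specialized polynomials `F_α` generate an ideal of `A[X]` with initial ideal
`J` (`HasInitial`): Buchberger's criterion for monic families gives one direction
(`hasInitial_specIdeal`), the vanishing of remainders the other (`eq_zero_of_mem_stratumIdeal`). An
ideal with initial ideal `J` has a unique reduced monic element over each basis monomial, and these
generate it. So the stratum represents `A ↦ {ideals of A[X] with initial ideal J}`, whatever the
reductions `H`, and a natural bijection of this functor with `A ↦ A^d` makes it an affine space
(`nonempty_algEquiv`).

The monomials of the ideals in question (the zero ideal apart) are those whose exponents at some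
listed variables are lexicographically at least a fixed `b` (`lexSet`). Let `x` be the first of
these variables: a monomial is in `J` when its exponent at `x` exceeds `b 0`, or equals `b 0` and
the rest lies in a set `J₂` of the same kind. The ideals with this initial ideal are the products `f
· (x + l, I₂)`, where `f` is monic with leading monomial `x^(b 0)`, `l` involves only the other
variables and has its terms below `x` and outside `J₂`, and `I₂` has initial ideal `J₂`; moreover
`f`, `l`, `I₂` are unique (`nest_injective`). The finitely many coefficients of `f` and `l` are
free, so induction on the number of listed variables yields an affine space.

The heart is the existence of `f` and `l` (`exists_nest`). In `I`, seen in `S[x]`, the elements of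
degree at most `b 0` are determined by their coefficient at `x^(b 0)`, which runs through `I₂`.
Multiplying such an element by `x` and subtracting the right multiple of the reduced element `F`
with leading monomial `x^(b 0 + 1)` induces an endomorphism of `I₂`. If it is the multiplication by
some `w ∈ S`, then `x - w` divides `F`, and the quotient is `f`. That all endomorphisms are scalar
passes from `I₂` to `f · (x + l, I₂)` (`hasScalarEnd_nest`), so this rigidity is carried along the
induction. -/

/-- A translation invariant strict partial order on monomials, all of whose tails are finite. -/
structure TailOrder (σ : Type*) where
  /-- The strict order relation. -/
  lt : (σ →₀ ℕ) → (σ →₀ ℕ) → Prop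
  irrefl : ∀ α, ¬ lt α α
  trans : ∀ {α β γ}, lt α β → lt β γ → lt α γ
  add_iff : ∀ {α β} γ, lt (α + γ) (β + γ) ↔ lt α β
  finite : ∀ α, {β | lt β α}.Finite

namespace TailOrder

variable {σ : Type*} (T : TailOrder σ)

/-- The set of monomials strictly below `X^α`. -/
def low (α : σ →₀ ℕ) : Set (σ →₀ ℕ) := {β | T.lt β α}

variable {T}

theorem add_iff' {α β : σ →₀ ℕ} (γ : σ →₀ ℕ) : T.lt (γ + α) (γ + β) ↔ T.lt α β := by
  rw [add_comm γ, add_comm γ, T.add_iff]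

theorem wf (T : TailOrder σ) : WellFounded T.lt := by
  refine ⟨fun α => ?_⟩
  suffices H : ∀ β, T.lt β α → Acc T.lt β from ⟨_, H⟩
  have : IsStrictOrder (σ →₀ ℕ) T.lt := { irrefl := T.irrefl, trans := fun _ _ _ => T.trans }
  have hwf : ({β | T.lt β α} : Set (σ →₀ ℕ)).WellFoundedOn T.lt := (T.finite α).wellFoundedOn
  intro β hβ
  exact Set.WellFoundedOn.induction hwf (P := fun β => Acc T.lt β) hβ
    fun β hβ ih => ⟨β, fun γ hγ => ih γ (T.trans hγ hβ) hγ⟩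

/-- By translation, `α + γ ≺ α` would start an infinite descent `α ≻ α + γ ≻ α + 2γ ≻ …`. Totality
of the order plays no role, which matters for homogeneous tails. -/
theorem not_lt_of_le {α β : σ →₀ ℕ} (h : α ≤ β) : ¬ T.lt β α := by
  obtain ⟨γ, rfl⟩ := le_iff_exists_add.mp h
  induction α using T.wf.induction generalizing γ with
  | _ α ih =>
  intro hlt
  refine ih _ hlt γ le_self_add ((T.add_iff γ).mpr hlt)

theorem add_lt_add {α β γ δ : σ →₀ ℕ} (h : T.lt α β) (h' : T.lt γ δ) : T.lt (α + γ) (β + δ) :=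
  T.trans ((T.add_iff γ).mpr h) ((add_iff' β).mpr h')

end TailOrder

/-! ### Monic polynomials and cancellation of monic factors -/

section Monic

variable {σ : Type*} {T : TailOrder σ} {A : Type*} [CommRing A]

/-- `g` is the sum of `X^α` and of terms strictly below `X^α`. -/
def IsMonicAt (T : TailOrder σ) (α : σ →₀ ℕ) (g : MvPolynomial σ A) : Prop :=
  g - monomial α 1 ∈ restrictSupport A (T.low α)

theorem mem_restrictSupport_iff_coeff {s : Set (σ →₀ ℕ)} {p : MvPolynomial σ A} :
    p ∈ restrictSupport A s ↔ ∀ β, coeff β p ≠ 0 → β ∈ s := by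
  rw [mem_restrictSupport_iff]
  simp [Set.subset_def]

theorem monomial_mul_mem_low {p : MvPolynomial σ A} {α : σ →₀ ℕ}
    (hp : p ∈ restrictSupport A (T.low α)) (γ : σ →₀ ℕ) (a : A) :
    monomial γ a * p ∈ restrictSupport A (T.low (γ + α)) := by
  classical
  rw [mem_restrictSupport_iff_coeff] at hp ⊢
  intro β hβ
  rw [coeff_monomial_mul'] at hβ
  split_ifs at hβ with h
  · have := hp _ (right_ne_zero_of_mul hβ)
    obtain ⟨δ, rfl⟩ := le_iff_exists_add.mp h
    rw [add_tsub_cancel_left] at this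
    exact (TailOrder.add_iff' γ).mpr this
  · exact absurd rfl hβ

theorem mul_mem_low {p q : MvPolynomial σ A} {α β : σ →₀ ℕ}
    (hp : p ∈ restrictSupport A (T.low α)) (hq : q ∈ restrictSupport A (T.low β)) :
    p * q ∈ restrictSupport A (T.low (α + β)) := by
  classical
  rw [mem_restrictSupport_iff_coeff] at hp hq ⊢
  intro γ hγ
  rw [coeff_mul] at hγ
  obtain ⟨x, hx, hne⟩ := Finset.exists_ne_zero_of_sum_ne_zero hγ
  rw [← Finset.HasAntidiagonal.mem_antidiagonal.mp hx]
  exact TailOrder.add_lt_add (hp _ (left_ne_zero_of_mul hne)) (hq _ (right_ne_zero_of_mul hne))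

theorem isMonicAt_monomial (α : σ →₀ ℕ) : IsMonicAt T α (monomial α (1 : A)) := by
  simp [IsMonicAt]

theorem IsMonicAt.mul {f g : MvPolynomial σ A} {α β : σ →₀ ℕ} (hf : IsMonicAt T α f)
    (hg : IsMonicAt T β g) : IsMonicAt T (α + β) (f * g) := by
  have h : f * g - monomial (α + β) 1 =
      (f - monomial α 1) * (g - monomial β 1) + monomial α 1 * (g - monomial β 1) +
        monomial β 1 * (f - monomial α 1) := by
    rw [show monomial (α + β) (1 : A) = monomial α 1 * monomial β 1 by simp]
    ring
  rw [IsMonicAt, h]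
  refine add_mem (add_mem (mul_mem_low hf hg) (monomial_mul_mem_low hg _ _)) ?_
  rw [add_comm α]
  exact monomial_mul_mem_low hf _ _

/-- Cancellation of a monic factor, at the level of supports. -/
theorem IsMonicAt.mem_restrictSupport_of_mul {g p : MvPolynomial σ A} {α : σ →₀ ℕ}
    (hg : IsMonicAt T α g) {U : Set (σ →₀ ℕ)} (hU : ∀ β ∈ U, ∀ γ, T.lt γ β → γ ∈ U)
    (h : ∀ β, coeff (β + α) (p * g) ≠ 0 → β ∈ U) : p ∈ restrictSupport A U := by
  classical
  by_contra hne
  rw [mem_restrictSupport_iff_coeff] at hne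
  push Not at hne
  have : IsStrictOrder (σ →₀ ℕ) T.lt := { irrefl := T.irrefl, trans := fun _ _ _ => T.trans }
  have hfin : {β | coeff β p ≠ 0 ∧ β ∉ U}.Finite :=
    p.support.finite_toSet.subset fun β hβ => by simpa using hβ.1
  -- Take a bad exponent `β` maximal for `≺`. The tail of `g` can contribute to the coefficient of
  -- `p * g` at `β + α` only through exponents of `p` above `β`; these are in `U`, forcing `β ∈ U`,
  -- or bad, against maximality. So that coefficient is the one of `p` at `β`.
  obtain ⟨⟨β, hβ⟩, -, hmax⟩ :=
    (hfin.wellFoundedOn (r := Function.swap T.lt)).has_min Set.univ ⟨⟨_, hne.choose_spec⟩, trivial⟩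
  have key : coeff (β + α) (p * (g - monomial α 1)) = 0 := by
    by_contra hc
    rw [coeff_mul] at hc
    obtain ⟨x, hx, hx0⟩ := Finset.exists_ne_zero_of_sum_ne_zero hc
    have h1 := mem_restrictSupport_iff_coeff.mp hg _ (right_ne_zero_of_mul hx0)
    have h2 : T.lt β x.1 := by
      rw [← T.add_iff x.2, Finset.HasAntidiagonal.mem_antidiagonal.mp hx, TailOrder.add_iff']
      exact h1
    by_cases hxU : x.1 ∈ U
    · exact hβ.2 (hU _ hxU _ h2)
    · exact hmax ⟨x.1, left_ne_zero_of_mul hx0, hxU⟩ trivial h2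
  rw [mul_sub, coeff_sub, sub_eq_zero, coeff_mul_monomial, mul_one] at key
  exact hβ.2 (h β (by rw [key]; exact hβ.1))

theorem IsMonicAt.mem_low_of_mul {g p : MvPolynomial σ A} {α δ : σ →₀ ℕ}
    (hg : IsMonicAt T α g) (h : p * g ∈ restrictSupport A (T.low (δ + α))) :
    p ∈ restrictSupport A (T.low δ) := by
  refine hg.mem_restrictSupport_of_mul (fun β hβ γ hγ => T.trans hγ hβ) fun β hβ => ?_
  exact (T.add_iff α).mp (mem_restrictSupport_iff_coeff.mp h _ hβ)

theorem IsMonicAt.eq_zero_of_mul {g p : MvPolynomial σ A} {α : σ →₀ ℕ}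
    (hg : IsMonicAt T α g) (h : p * g = 0) : p = 0 := by
  have := hg.mem_restrictSupport_of_mul (p := p) (U := ∅) (by simp) (by simp [h])
  rw [mem_restrictSupport_iff_coeff] at this
  ext β
  by_contra hβ
  exact this β hβ

end Monic

/-! ### Ideals with a prescribed initial ideal -/

section Points

variable {σ : Type*} (T : TailOrder σ) (J : Set (σ →₀ ℕ)) {A : Type*} [CommRing A]

/-- The ideal `I` of `A[X]` has initial ideal `J`: it contains a monic polynomial with leading
monomial `X^α` for every `α ∈ J`, and no nonzero polynomial supported outside `J`. -/
structure HasInitial (I : Ideal (MvPolynomial σ A)) : Prop where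
  exists_monic : ∀ α ∈ J, ∃ F ∈ I, IsMonicAt T α F
  eq_zero : ∀ f ∈ I, f ∈ restrictSupport A Jᶜ → f = 0

/-- `F` is the sum of `X^α` and of terms strictly below `X^α` outside `J`. -/
def IsReducedAt (α : σ →₀ ℕ) (F : MvPolynomial σ A) : Prop :=
  F - monomial α 1 ∈ restrictSupport A (T.low α ∩ Jᶜ)

variable {T J}

theorem IsReducedAt.isMonicAt {α : σ →₀ ℕ} {F : MvPolynomial σ A} (h : IsReducedAt T J α F) :
    IsMonicAt T α F :=
  restrictSupport_mono _ Set.inter_subset_left h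

/-- This is division with remainder, as an induction on `≺`: for `α ∈ J`, the monomial `X^α` is
congruent modulo `I` to a combination of smaller monomials. Since `D` is closed downwards, the
remainder stays in `D`. -/
theorem restrictSupport_le_sup {I : Ideal (MvPolynomial σ A)}
    (hI : ∀ α ∈ J, ∃ F ∈ I, IsMonicAt T α F) {D : Set (σ →₀ ℕ)}
    (hD : ∀ β ∈ D, ∀ γ, T.lt γ β → γ ∈ D) :
    restrictSupport A D ≤ I.restrictScalars A ⊔ restrictSupport A (D ∩ Jᶜ) := by
  have key : ∀ α ∈ D, monomial α (1 : A) ∈ I.restrictScalars A ⊔ restrictSupport A (D ∩ Jᶜ) := by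
    intro α
    induction α using T.wf.induction with
    | _ α ih =>
    intro hα
    by_cases hJ : α ∈ J
    · obtain ⟨F, hF, hm⟩ := hI α hJ
      rw [show monomial α (1 : A) = F - (F - monomial α 1) by ring]
      refine sub_mem (Submodule.mem_sup_left hF) ?_
      rw [IsMonicAt, restrictSupport_eq_span] at hm
      refine (Submodule.span_le.mpr ?_) hm
      rintro _ ⟨β, hβ, rfl⟩
      exact ih β hβ (hD _ hα _ hβ)
    · exact Submodule.mem_sup_right (by simp [hα, hJ])
  rw [restrictSupport_eq_span, Submodule.span_le]
  rintro _ ⟨β, hβ, rfl⟩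
  exact key β hβ

theorem exists_normalForm {I : Ideal (MvPolynomial σ A)}
    (hI : ∀ α ∈ J, ∃ F ∈ I, IsMonicAt T α F) {D : Set (σ →₀ ℕ)}
    (hD : ∀ β ∈ D, ∀ γ, T.lt γ β → γ ∈ D) {p : MvPolynomial σ A}
    (hp : p ∈ restrictSupport A D) : ∃ h ∈ restrictSupport A (D ∩ Jᶜ), p - h ∈ I := by
  obtain ⟨g, hg, h, hh, rfl⟩ := Submodule.mem_sup.mp (restrictSupport_le_sup hI hD hp)
  exact ⟨h, hh, by simpa using! hg⟩

theorem HasInitial.exists_isReducedAt {I : Ideal (MvPolynomial σ A)} (hI : HasInitial T J I)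
    {α : σ →₀ ℕ} (hα : α ∈ J) : ∃ F ∈ I, IsReducedAt T J α F := by
  obtain ⟨F, hF, hm⟩ := hI.exists_monic α hα
  obtain ⟨h, hh, hFh⟩ := exists_normalForm hI.exists_monic (fun β hβ γ hγ => T.trans hγ hβ) hm
  refine ⟨F - (F - monomial α 1 - h), sub_mem hF hFh, ?_⟩
  rwa [IsReducedAt, show F - (F - monomial α 1 - h) - monomial α 1 = h by ring]

theorem HasInitial.eq_of_isReducedAt {I : Ideal (MvPolynomial σ A)} (hI : HasInitial T J I)
    {α : σ →₀ ℕ} {F G : MvPolynomial σ A} (hF : F ∈ I) (hG : G ∈ I)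
    (hF' : IsReducedAt T J α F) (hG' : IsReducedAt T J α G) : F = G := by
  rw [← sub_eq_zero]
  refine hI.eq_zero _ (sub_mem hF hG) ?_
  rw [show F - G = (F - monomial α 1) - (G - monomial α 1) by ring]
  exact restrictSupport_mono _ Set.inter_subset_right (sub_mem hF' hG')

/-- An ideal with initial ideal `J` is generated by any of its families of monic polynomials that
reach all of `J`. -/
theorem HasInitial.eq_of_le {I I' : Ideal (MvPolynomial σ A)} (hI : HasInitial T J I)
    (hI' : ∀ α ∈ J, ∃ F ∈ I', IsMonicAt T α F) (hle : I' ≤ I) : I' = I := by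
  refine le_antisymm hle fun p hp => ?_
  obtain ⟨h, hh, hph⟩ := exists_normalForm (D := Set.univ) (p := p) hI' (by simp) (by simp)
  have h0 : h = 0 := by
    refine hI.eq_zero _ ?_ (restrictSupport_mono _ Set.inter_subset_right hh)
    simpa using sub_mem hp (hle hph)
  simpa [h0] using hph

end Points

section PolyOf

variable {σ : Type*} {A B : Type*} [CommRing A] [CommRing B] {s : Set (σ →₀ ℕ)} [Fintype s]

/-- The polynomial with given coefficients at the monomials of a finite set. -/
noncomputable def polyOf (v : s → A) : MvPolynomial σ A := ∑ β : s, monomial β.1 (v β)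

theorem coeff_polyOf (v : s → A) (β : s) : coeff β.1 (polyOf v) = v β := by
  classical
  rw [polyOf, coeff_sum, Finset.sum_eq_single β]
  · simp
  · intro γ _ hγ
    rw [coeff_monomial, if_neg fun h => hγ (Subtype.ext h)]
  · simp

theorem polyOf_mem (v : s → A) : polyOf v ∈ restrictSupport A s :=
  sum_mem fun β _ => by simp

theorem polyOf_injective : Function.Injective (polyOf : (s → A) → MvPolynomial σ A) :=
  fun v w h => funext fun β => by rw [← coeff_polyOf v, h, coeff_polyOf]

theorem exists_polyOf {p : MvPolynomial σ A} (hp : p ∈ restrictSupport A s) :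
    ∃ v : s → A, polyOf v = p := by
  refine ⟨fun β => coeff β.1 p, ?_⟩
  ext β
  by_cases hβ : β ∈ s
  · exact coeff_polyOf (A := A) (fun β : s => coeff β.1 p) ⟨β, hβ⟩
  · have h1 : ∀ q ∈ restrictSupport A s, coeff β q = 0 := fun q hq => by
      by_contra h
      exact hβ (mem_restrictSupport_iff_coeff.mp hq β h)
    rw [h1 _ hp, h1 _ (polyOf_mem _)]

theorem map_polyOf (h : A →+* B) (v : s → A) : map h (polyOf v) = polyOf (h ∘ v) := by
  simp [polyOf, map_monomial]

end PolyOf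

end Strata

/-! ### Univariate algebra of the ideals `f · (X + l, I₂)` -/

namespace Strata

section Nest

open Polynomial

variable {S : Type*} [CommRing S]

/-- Every endomorphism of the ideal `I` is the multiplication by an element of the ring. -/
def HasScalarEnd {R : Type*} [CommRing R] (I : Ideal R) : Prop :=
  ∀ ψ : R → R, (∀ g ∈ I, ψ g ∈ I) → (∀ r, ∀ g ∈ I, ψ (r * g) = r * ψ g) →
    ∃ w, ∀ g ∈ I, ψ g = w * g

theorem hasScalarEnd_top {R : Type*} [CommRing R] : HasScalarEnd (⊤ : Ideal R) :=
  fun ψ _ h => ⟨ψ 1, fun g _ => by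
    rw [mul_comm, ← h g 1 trivial, mul_one]⟩

theorem HasScalarEnd.of_ringEquiv {R R' : Type*} [CommRing R] [CommRing R'] (E : R ≃+* R')
    {I : Ideal R} {I' : Ideal R'} (hII' : ∀ p, E p ∈ I' ↔ p ∈ I) (h : HasScalarEnd I') :
    HasScalarEnd I := by
  intro ψ h1 h2
  have hs : ∀ g, g ∈ I' → E.symm g ∈ I := fun g hg => by simpa [← hII'] using hg
  obtain ⟨w, hw⟩ := h (fun g => E (ψ (E.symm g))) (fun g hg => (hII' _).mpr (h1 _ (hs g hg)))
    (fun r g hg => by simp [h2 _ _ (hs g hg)])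
  refine ⟨E.symm w, fun g hg => E.injective ?_⟩
  simpa using hw (E g) ((hII' g).mpr hg)

theorem X_add_C_dvd_iff {l : S} {q : S[X]} : X + C l ∣ q ↔ q.eval (-l) = 0 := by
  rw [← Polynomial.IsRoot.def, ← Polynomial.dvd_iff_isRoot, C_neg, sub_neg_eq_add]

/-- Modulo `X + l` a polynomial is congruent to its value at `-l`, so membership in `(X + l, I₂)` is
tested on that value. -/
theorem mem_nest_iff {f : S[X]} {l : S} {I₂ : Ideal S} {p : S[X]} :
    p ∈ Ideal.span {f} * (Ideal.span {X + C l} ⊔ I₂.map C) ↔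
      ∃ q, p = f * q ∧ q.eval (-l) ∈ I₂ := by
  rw [Ideal.mem_span_singleton_mul]
  refine exists_congr fun q => ?_
  rw [and_comm, eq_comm]
  refine and_congr_right fun _ => ?_
  constructor
  · intro h
    have hle : Ideal.span {X + C l} ⊔ I₂.map C ≤ I₂.comap (evalRingHom (-l)) := by
      rw [sup_le_iff, Ideal.span_singleton_le_iff_mem, Ideal.map_le_iff_le_comap]
      constructor
      · simp
      · intro g hg
        simpa using hg
    exact hle h
  · intro h
    obtain ⟨w, hw⟩ : X + C l ∣ q - C (q.eval (-l)) := by simp [X_add_C_dvd_iff]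
    rw [← sub_add_cancel q (C (q.eval (-l))), hw]
    exact add_mem (Submodule.mem_sup_left
      (Ideal.mul_mem_right _ _ (Ideal.mem_span_singleton_self _)))
      (Submodule.mem_sup_right (Ideal.mem_map_of_mem _ h))

/-- The ideal of leading coefficients of the elements of degree at most `b` of `I`. -/
def leadIdeal (I : Ideal S[X]) (b : ℕ) : Ideal S where
  carrier := {g | ∃ p ∈ I, p.natDegree ≤ b ∧ p.coeff b = g}
  zero_mem' := ⟨0, I.zero_mem, by simp⟩
  add_mem' := by
    rintro _ _ ⟨p, hp, hpd, rfl⟩ ⟨q, hq, hqd, rfl⟩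
    exact ⟨p + q, add_mem hp hq, natDegree_add_le_of_degree_le hpd hqd, by simp⟩
  smul_mem' := by
    rintro r _ ⟨p, hp, hpd, rfl⟩
    exact ⟨C r * p, I.mul_mem_left _ hp, (natDegree_C_mul_le _ _).trans hpd, by simp⟩

/-- The elements of `f (X + l, I₂)` of degree at most `deg f`. -/
theorem exists_of_mem_nest {f : S[X]} (hf : f.Monic) {b : ℕ} (hb : f.natDegree = b) {l : S}
    {I₂ : Ideal S} {p : S[X]} (hp : ∃ q, p = f * q ∧ q.eval (-l) ∈ I₂) (hd : p.natDegree ≤ b) :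
    p.coeff b ∈ I₂ ∧ p = f * C (p.coeff b) := by
  subst hb
  nontriviality S
  obtain ⟨q, rfl, hq⟩ := hp
  by_cases h0 : q = 0
  · simp [h0]
  rw [hf.natDegree_mul' h0] at hd
  obtain ⟨g, rfl⟩ : ∃ g, C g = q := natDegree_eq_zero.mp (by omega)
  rw [coeff_mul_C, hf.coeff_natDegree, one_mul]
  simpa using hq

theorem leadIdeal_nest {f : S[X]} (hf : f.Monic) {b : ℕ} (hb : f.natDegree = b) {l : S}
    {I₂ : Ideal S} {I : Ideal S[X]} (hI : ∀ p, p ∈ I ↔ ∃ q, p = f * q ∧ q.eval (-l) ∈ I₂) :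
    leadIdeal I b = I₂ := by
  subst hb
  refine le_antisymm ?_ fun g hg => ⟨f * C g, (hI _).mpr ⟨C g, rfl, by simpa using hg⟩, ?_, ?_⟩
  · rintro _ ⟨p, hp, hpd, rfl⟩
    exact (exists_of_mem_nest hf rfl ((hI p).mp hp) hpd).1
  · exact natDegree_mul_C_le _ _
  · rw [coeff_mul_C, hf.coeff_natDegree, one_mul]

/-- The data are read off `I`: `I₂` is the ideal of leading coefficients in degree `b`; the element
of degree at most `b` with the regular leading coefficient `g` is both `f g` and `f' g`, so `f =
f'`; finally `f (X + l) ∈ I`, tested against the second description, gives `l - l' ∈ I₂`. -/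
theorem nest_injective {f f' : S[X]} (hf : f.Monic) (hf' : f'.Monic) {b : ℕ}
    (hb : f.natDegree = b) (hb' : f'.natDegree = b) {l l' : S} {I₂ I₂' : Ideal S} {I : Ideal S[X]}
    (hI : ∀ p, p ∈ I ↔ ∃ q, p = f * q ∧ q.eval (-l) ∈ I₂)
    (hI' : ∀ p, p ∈ I ↔ ∃ q, p = f' * q ∧ q.eval (-l') ∈ I₂') {g : S} (hg : g ∈ I₂)
    (hg0 : ∀ r, r * g = 0 → r = 0) : I₂ = I₂' ∧ f = f' ∧ l - l' ∈ I₂ := by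
  have h2 : I₂ = I₂' := by rw [← leadIdeal_nest hf hb hI, leadIdeal_nest hf' hb' hI']
  have h1 : f = f' := by
    have hc : (f * C g).coeff b = g := by
      rw [← hb, coeff_mul_C, hf.coeff_natDegree, one_mul]
    have := (exists_of_mem_nest hf' hb' ((hI' _).mp ((hI (f * C g)).mpr
      ⟨C g, rfl, by simpa using hg⟩)) (by rw [← hb]; exact natDegree_mul_C_le _ _)).2
    rw [hc, ← sub_eq_zero, ← sub_mul] at this
    rw [← sub_eq_zero]
    ext n
    exact hg0 _ (by rw [← coeff_mul_C, this]; simp)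
  refine ⟨h2, h1, ?_⟩
  obtain ⟨q, hq, hq'⟩ := (hI' _).mp ((hI (f * (X + C l))).mpr ⟨_, rfl, by simp⟩)
  rw [← h1] at hq
  rw [← hf.isRegular.left hq, ← h2] at hq'
  have : -l' + l ∈ I₂ := by simpa using hq'
  rwa [neg_add_eq_sub] at this

theorem nest_congr {f : S[X]} {l l' : S} {I₂ : Ideal S} (h : l - l' ∈ I₂) {p : S[X]} :
    (∃ q, p = f * q ∧ q.eval (-l) ∈ I₂) ↔ ∃ q, p = f * q ∧ q.eval (-l') ∈ I₂ := by
  refine exists_congr fun q => and_congr_right fun _ => ?_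
  have h1 : q.eval (-l) - q.eval (-l') ∈ I₂ := by
    refine I₂.mem_of_dvd (sub_dvd_eval_sub _ _ _) ?_
    rw [show -l - -l' = -(l - l') by ring]
    exact neg_mem h
  exact ⟨fun h2 => by simpa using sub_mem h2 h1, fun h2 => by simpa using add_mem h1 h2⟩

/-- Write `ψ (f (X + l)) = f u` and `ψ (f g) = f v`. Linearity gives `g u = (X + l) v`, hence `g
u(-l) = 0`, and regularity of `g` makes `X + l` divide `u`. The quotient is the scalar, because `f
(X + l)` is monic and so can be cancelled. -/
theorem hasScalarEnd_nest {f : S[X]} (hf : f.Monic) {l : S} {I₂ : Ideal S} {I : Ideal S[X]}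
    (hI : ∀ p, p ∈ I ↔ ∃ q, p = f * q ∧ q.eval (-l) ∈ I₂) {g : S} (hg : g ∈ I₂)
    (hg0 : ∀ r, r * g = 0 → r = 0) : HasScalarEnd I := by
  intro ψ h1 h2
  have hcan : ∀ p q : S[X], f * p = f * q → p = q := fun p q h => hf.isRegular.left h
  have hl : (X + C l : S[X]).Monic := monic_X_add_C l
  have hfl : f * (X + C l) ∈ I := (hI _).mpr ⟨_, rfl, by simp⟩
  have hfg : f * C g ∈ I := (hI _).mpr ⟨_, rfl, by simpa using hg⟩
  obtain ⟨u, hu, -⟩ := (hI _).mp (h1 _ hfl)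
  obtain ⟨v, hv, -⟩ := (hI _).mp (h1 _ hfg)
  have e1 : C g * u = (X + C l) * v := by
    apply hcan
    have := h2 (C g) _ hfl
    rw [show C g * (f * (X + C l)) = (X + C l) * (f * C g) by ring, h2 _ _ hfg, hu, hv] at this
    linear_combination -this
  obtain ⟨w, rfl⟩ : X + C l ∣ u := by
    rw [X_add_C_dvd_iff]
    apply hg0
    simpa [mul_comm] using congrArg (eval (-l)) e1
  refine ⟨w, fun p hp => ?_⟩
  have e2 : f * (X + C l) * ψ p = f * (X + C l) * (w * p) := by
    rw [← h2 _ _ hp, mul_comm _ p, h2 _ _ hfl, hu]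
    ring
  exact (hf.mul hl).isRegular.left e2

theorem natDegree_mul_sub_le {p F : S[X]} {b : ℕ} (hp : p.natDegree ≤ b) (hF : F.Monic)
    (hFd : F.natDegree = b + 1) : (X * p - C (p.coeff b) * F).natDegree ≤ b := by
  rw [natDegree_le_iff_coeff_eq_zero]
  intro N hN
  obtain ⟨N, rfl⟩ : ∃ M, N = M + 1 := ⟨N - 1, by omega⟩
  rw [coeff_sub, coeff_X_mul, coeff_C_mul]
  rcases Nat.lt_or_ge b N with h | h
  · rw [coeff_eq_zero_of_natDegree_lt (p := p) (n := N) (by omega),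
      coeff_eq_zero_of_natDegree_lt (p := F) (by omega)]
    simp
  · obtain rfl : N = b := by omega
    rw [← hFd, hF.coeff_natDegree]
    simp

/-- An ideal containing a monic polynomial of degree `b + 1`, in which the elements of degree at
most `b` are determined by their coefficient in degree `b`, is of the form `f (X + l, I₂)`. -/
theorem exists_nest {I : Ideal S[X]} {b : ℕ} {F : S[X]} (hFI : F ∈ I) (hF : F.Monic)
    (hFd : F.natDegree = b + 1) (hinj : ∀ p ∈ I, p.natDegree ≤ b → p.coeff b = 0 → p = 0)
    {g₀ : S} (hg : g₀ ∈ leadIdeal I b) (hg0 : ∀ r, r * g₀ = 0 → r = 0)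
    (hend : HasScalarEnd (leadIdeal I b)) :
    ∃ (f : S[X]) (l : S), f.Monic ∧ f.natDegree = b ∧ F = f * (X + C l) ∧
      ∀ p, p ∈ I ↔ ∃ q, p = f * q ∧ q.eval (-l) ∈ leadIdeal I b := by
  have : Nontrivial S := by
    by_contra h
    rw [not_nontrivial_iff_subsingleton] at h
    rw [Subsingleton.elim F 0, natDegree_zero] at hFd
    omega
  -- `φ g` will be the unique element of `I` of degree at most `b` with coefficient `g` at `X^b`.
  -- The implication makes `φ` total; its values outside the leading ideal are unconstrained.
  have hex : ∀ g : S, ∃ p : S[X], g ∈ leadIdeal I b → p ∈ I ∧ p.natDegree ≤ b ∧ p.coeff b = g := by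
    intro g
    by_cases h : g ∈ leadIdeal I b
    · obtain ⟨p, hp⟩ := h
      exact ⟨p, fun _ => hp⟩
    · exact ⟨0, fun h' => absurd h' h⟩
  choose φ hφ using hex
  have huniq : ∀ p ∈ I, ∀ q ∈ I, p.natDegree ≤ b → q.natDegree ≤ b → p.coeff b = q.coeff b →
      p = q := by
    intro p hp q hq hpd hqd h
    rw [← sub_eq_zero]
    exact hinj _ (sub_mem hp hq) ((natDegree_sub_le_of_le hpd hqd).trans (max_self b).le)
      (by simp [h])
  have hmem : ∀ p ∈ I, X * p - C (p.coeff b) * F ∈ I := fun p hp =>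
    sub_mem (I.mul_mem_left _ hp) (I.mul_mem_left _ hFI)
  have hφmul : ∀ r, ∀ g ∈ leadIdeal I b, φ (r * g) = C r * φ g := by
    intro r g hg
    have h1 := hφ _ ((leadIdeal I b).mul_mem_left r hg)
    have h2 := hφ g hg
    exact huniq _ h1.1 _ (I.mul_mem_left _ h2.1) h1.2.1
      ((natDegree_C_mul_le _ _).trans h2.2.1) (by simp [h1.2.2, h2.2.2])
  -- Multiplication by `X`, corrected by a multiple of `F` to return to degree at most `b`, is an
  -- endomorphism of the leading ideal; rigidity makes it the multiplication by `w`.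
  obtain ⟨w, hw⟩ := hend (fun g => (X * φ g - C g * F).coeff b)
    (by
      intro g hg
      obtain ⟨h1, h2, h3⟩ := hφ g hg
      refine ⟨X * φ g - C g * F, ?_, ?_, rfl⟩
      · simpa only [h3] using hmem _ h1
      · simpa only [h3] using natDegree_mul_sub_le h2 hF hFd)
    (by
      intro r g hg
      simp only [hφmul r g hg, C_mul]
      rw [show X * (C r * φ g) - C r * C g * F = C r * (X * φ g - C g * F) by ring, coeff_C_mul])
  have hrel : ∀ g ∈ leadIdeal I b, (X + C (-w)) * φ g = C g * F := by
    intro g hg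
    obtain ⟨h1, h2, h3⟩ := hφ g hg
    have : X * φ g - C g * F = C w * φ g := by
      refine huniq _ (by simpa only [h3] using hmem _ h1) _ (I.mul_mem_left _ h1)
        (by simpa only [h3] using natDegree_mul_sub_le h2 hF hFd)
        ((natDegree_C_mul_le _ _).trans h2) ?_
      rw [hw g hg, coeff_C_mul, h3]
    rw [C_neg]
    linear_combination this
  -- At `X = w` the relation `(X - w) φ(g₀) = g₀ F` reads `g₀ F(w) = 0`, and `g₀` is regular.
  obtain ⟨f, hf⟩ : X + C (-w) ∣ F := by
    rw [X_add_C_dvd_iff]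
    apply hg0
    have := congrArg (eval (- -w)) (hrel g₀ hg)
    simpa [mul_comm] using this.symm
  have hl : (X + C (-w) : S[X]).Monic := monic_X_add_C _
  have hfm : f.Monic := hl.of_mul_monic_left (hf ▸ hF)
  have hfd : f.natDegree = b := by
    have := hl.natDegree_mul hfm
    rw [← hf, hFd, natDegree_X_add_C] at this
    omega
  have hφf : ∀ g ∈ leadIdeal I b, φ g = f * C g := by
    intro g hg
    apply hl.isRegular.left
    simp only
    rw [hrel g hg, hf]
    ring
  have hfg : ∀ g ∈ leadIdeal I b, f * C g ∈ I := fun g hg => hφf g hg ▸ (hφ g hg).1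
  -- Division by `F = f (X - w)` leaves a remainder of degree at most `b`, which is `f` times an
  -- element of the leading ideal.
  refine ⟨f, -w, hfm, hfd, by rw [hf, mul_comm], fun p => ⟨fun hp => ?_, ?_⟩⟩
  · have hr : p %ₘ F ∈ I := by
      rw [modByMonic_eq_sub_mul_div]
      exact sub_mem hp (I.mul_mem_right _ hFI)
    have hrd : (p %ₘ F).natDegree ≤ b := by
      have := natDegree_modByMonic_lt p hF (by rintro rfl; simp at hFd)
      omega
    have hlead : (p %ₘ F).coeff b ∈ leadIdeal I b := ⟨_, hr, hrd, rfl⟩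
    have h3 : p %ₘ F = f * C ((p %ₘ F).coeff b) := by
      rw [← hφf _ hlead]
      have := hφ _ hlead
      exact huniq _ hr _ this.1 hrd this.2.1 this.2.2.symm
    refine ⟨C ((p %ₘ F).coeff b) + (X + C (-w)) * (p /ₘ F), ?_, by simpa using hlead⟩
    linear_combination -(modByMonic_add_div p F) + h3 + (p /ₘ F) * hf
  · rintro ⟨q, rfl, hq⟩
    obtain ⟨u, hu⟩ : X + C (-w) ∣ q - C (q.eval (- -w)) := by
      rw [X_add_C_dvd_iff]; simp
    rw [← sub_add_cancel q (C (q.eval (- -w))), hu, mul_add]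
    refine add_mem ?_ (hfg _ hq)
    rw [← mul_assoc, mul_comm f, ← hf]
    exact I.mul_mem_right _ hFI

end Nest

end Strata

/-! ### Separating one variable in multivariate polynomials -/

namespace Strata

open MvPolynomial

section Glue

variable {σ σ' : Type*} (e : Option σ' ≃ σ)

/-- The exponent with components `ν` and with component `n` at the distinguished variable. -/
noncomputable def glue (ν : σ' →₀ ℕ) (n : ℕ) : σ →₀ ℕ := (ν.optionElim n).mapDomain e

@[simp]
theorem glue_none (ν : σ' →₀ ℕ) (n : ℕ) : glue e ν n (e none) = n := by
  rw [glue, Finsupp.mapDomain_apply e.injective, Finsupp.optionElim_apply_none]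

@[simp]
theorem glue_some (ν : σ' →₀ ℕ) (n : ℕ) (j : σ') : glue e ν n (e (some j)) = ν j := by
  rw [glue, Finsupp.mapDomain_apply e.injective, Finsupp.optionElim_apply_some]

theorem ext_option {μ ν : σ →₀ ℕ} (h : μ (e none) = ν (e none))
    (h' : ∀ j, μ (e (some j)) = ν (e (some j))) : μ = ν := by
  ext i
  obtain ⟨i | i, rfl⟩ := e.surjective i
  · exact h
  · exact h' i

theorem glue_add (ν ν' : σ' →₀ ℕ) (n n' : ℕ) :
    glue e (ν + ν') (n + n') = glue e ν n + glue e ν' n' :=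
  ext_option e (by simp) (by simp)

theorem glue_injective {ν ν' : σ' →₀ ℕ} {n n' : ℕ} (h : glue e ν n = glue e ν' n') :
    ν = ν' ∧ n = n' := by
  refine ⟨?_, ?_⟩
  · ext j
    rw [← glue_some e ν n, h, glue_some]
  · rw [← glue_none e ν n, h, glue_none]

/-- The components of `μ` at the non-distinguished variables. -/
noncomputable def res (μ : σ →₀ ℕ) : σ' →₀ ℕ :=
  μ.comapDomain (fun j => e (some j)) ((e.injective.comp (Option.some_injective _)).injOn)

@[simp]
theorem res_apply (μ : σ →₀ ℕ) (j : σ') : res e μ j = μ (e (some j)) := rfl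

@[simp]
theorem glue_res (μ : σ →₀ ℕ) : glue e (res e μ) (μ (e none)) = μ :=
  ext_option e (by simp) (by simp)

@[simp]
theorem res_glue (ν : σ' →₀ ℕ) (n : ℕ) : res e (glue e ν n) = ν := by
  ext j
  simp

theorem glue_le {ν ν' : σ' →₀ ℕ} {n n' : ℕ} (h : ν ≤ ν') (h' : n ≤ n') :
    glue e ν n ≤ glue e ν' n' := by
  intro i
  obtain ⟨i | i, rfl⟩ := e.surjective i
  · simpa using h'
  · simpa using h i

theorem single_eq_glue (n : ℕ) : Finsupp.single (e none) n = glue e 0 n :=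
  ext_option e (by simp) (by simp)

/-- The order induced on the monomials not involving the distinguished variable. -/
def TailOrder.induced (T : TailOrder σ) : TailOrder σ' where
  lt ν ν' := T.lt (glue e ν 0) (glue e ν' 0)
  irrefl _ := T.irrefl _
  trans := T.trans
  add_iff γ := by
    have h : ∀ ν, glue e (ν + γ) 0 = glue e ν 0 + glue e γ 0 := fun ν => glue_add e ν γ 0 0
    rw [h, h, T.add_iff]
  finite α := (T.finite (glue e α 0)).preimage fun _ _ _ _ h => (glue_injective e h).1

variable {e} in
theorem TailOrder.lt_glue_iff {T : TailOrder σ} {ν ν' : σ' →₀ ℕ} (n : ℕ) :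
    T.lt (glue e ν n) (glue e ν' n) ↔ (T.induced e).lt ν ν' := by
  have h : ∀ ν, glue e ν n = glue e ν 0 + glue e 0 n := fun ν => by
    rw [← glue_add, add_zero, zero_add]
  rw [h, h ν', T.add_iff]
  rfl

variable {e} in
-- Otherwise `x^b` would divide a monomial below it. Hence a polynomial monic at `x^b` for the order
-- is also monic of degree `b` as a univariate polynomial in `x`.
theorem TailOrder.lt_of_lt_glue {T : TailOrder σ} {ν : σ' →₀ ℕ} {n b : ℕ}
    (h : T.lt (glue e ν n) (glue e 0 b)) : n < b := by
  by_contra hn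
  exact TailOrder.not_lt_of_le (glue_le e (zero_le) (not_lt.mp hn)) h

/-- The exponents exceeding `b` at the distinguished variable, or equal to `b` there and with
the other components in `J₂`. -/
def stepSet (b : ℕ) (J₂ : Set (σ' →₀ ℕ)) : Set (σ →₀ ℕ) :=
  {μ | b < μ (e none) ∨ μ (e none) = b ∧ res e μ ∈ J₂}

theorem glue_mem_stepSet {b n : ℕ} {J₂ : Set (σ' →₀ ℕ)} {ν : σ' →₀ ℕ} :
    glue e ν n ∈ stepSet e b J₂ ↔ b < n ∨ n = b ∧ ν ∈ J₂ := by
  simp [stepSet]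

variable (A : Type*) [CommRing A]

/-- Polynomials as univariate polynomials in the distinguished variable. -/
noncomputable def splitEquiv : MvPolynomial σ A ≃+* Polynomial (MvPolynomial σ' A) :=
  ((renameEquiv A e.symm).trans (optionEquivLeft A σ')).toRingEquiv

/-- The inclusion of the polynomials not involving the distinguished variable. -/
noncomputable def incl : MvPolynomial σ' A →+* MvPolynomial σ A :=
  (rename fun j => e (some j)).toRingHom

variable {A}

theorem coeff_splitEquiv (p : MvPolynomial σ A) (ν : σ' →₀ ℕ) (n : ℕ) :
    coeff ν ((splitEquiv e A p).coeff n) = coeff (glue e ν n) p := by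
  change coeff ν ((optionEquivLeft A σ' (rename e.symm p)).coeff n) = _
  rw [optionEquivLeft_coeff_coeff, ← coeff_rename_mapDomain e e.injective, rename_rename]
  simp [glue, rename_id]

theorem monomial_glue_one : monomial (glue e 0 1) (1 : A) = X (e none) := by
  rw [← single_eq_glue, X]

@[simp]
theorem splitEquiv_X : splitEquiv e A (X (e none)) = Polynomial.X := by
  simp [splitEquiv, optionEquivLeft_X_none]

@[simp]
theorem splitEquiv_incl (p : MvPolynomial σ' A) :
    splitEquiv e A (incl e A p) = Polynomial.C p := by
  induction p using MvPolynomial.induction_on with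
  | C a => simp [splitEquiv, incl, optionEquivLeft_C]
  | add p q hp hq => rw [map_add, map_add, hp, hq, map_add]
  | mul_X p i hp =>
    rw [map_mul, map_mul, hp, map_mul]
    simp [splitEquiv, incl, optionEquivLeft_X_some]

theorem coeff_glue_incl (p : MvPolynomial σ' A) (ν : σ' →₀ ℕ) (n : ℕ) :
    coeff (glue e ν n) (incl e A p) = if n = 0 then coeff ν p else 0 := by
  rw [← coeff_splitEquiv, splitEquiv_incl, Polynomial.coeff_C]
  split_ifs <;> simp

/-- The ideal `f (x + l, I₂)`, where `x` is the distinguished variable. -/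
noncomputable def nestIdeal (f : MvPolynomial σ A) (l : MvPolynomial σ' A)
    (I₂ : Ideal (MvPolynomial σ' A)) : Ideal (MvPolynomial σ A) :=
  Ideal.span {f} * (Ideal.span {X (e none) + incl e A l} ⊔ I₂.map (incl e A))

theorem mem_map_splitEquiv {I : Ideal (MvPolynomial σ A)} {p : MvPolynomial σ A} :
    splitEquiv e A p ∈ I.map (splitEquiv e A) ↔ p ∈ I := by
  rw [Ideal.mem_map_of_equiv]
  exact ⟨fun ⟨x, hx, h⟩ => (splitEquiv e A).injective h ▸ hx, fun h => ⟨p, h, rfl⟩⟩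

theorem map_nestIdeal (f : MvPolynomial σ A) (l : MvPolynomial σ' A)
    (I₂ : Ideal (MvPolynomial σ' A)) : (nestIdeal e f l I₂).map (splitEquiv e A) =
      Ideal.span {splitEquiv e A f} *
        (Ideal.span {Polynomial.X + Polynomial.C l} ⊔ I₂.map Polynomial.C) := by
  have h : (I₂.map (incl e A)).map (splitEquiv e A) = I₂.map Polynomial.C := by
    rw [← Ideal.map_coe (splitEquiv e A), Ideal.map_map]
    congr 1
    exact RingHom.ext (splitEquiv_incl e)
  rw [nestIdeal, Ideal.map_mul, Ideal.map_sup, Ideal.map_span, Ideal.map_span, h]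
  simp only [Set.image_singleton, map_add, splitEquiv_X, splitEquiv_incl]

theorem mem_nestIdeal {f : MvPolynomial σ A} {l : MvPolynomial σ' A}
    {I₂ : Ideal (MvPolynomial σ' A)} (P : Polynomial (MvPolynomial σ' A)) :
    P ∈ (nestIdeal e f l I₂).map (splitEquiv e A) ↔
      ∃ q, P = splitEquiv e A f * q ∧ q.eval (-l) ∈ I₂ := by
  rw [map_nestIdeal, mem_nest_iff]

theorem map_incl {B : Type*} [CommRing B] (h : A →+* B) (p : MvPolynomial σ' A) :
    MvPolynomial.map h (incl e A p) = incl e B (MvPolynomial.map h p) :=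
  map_rename _ _ _

theorem nestIdeal_map {B : Type*} [CommRing B] (h : A →+* B) (f : MvPolynomial σ A)
    (l : MvPolynomial σ' A) (I₂ : Ideal (MvPolynomial σ' A)) :
    (nestIdeal e f l I₂).map (MvPolynomial.map h) =
      nestIdeal e (MvPolynomial.map h f) (MvPolynomial.map h l) (I₂.map (MvPolynomial.map h)) := by
  have h2 : (I₂.map (incl e A)).map (MvPolynomial.map h) =
      (I₂.map (MvPolynomial.map h)).map (incl e B) := by
    rw [Ideal.map_map, Ideal.map_map]
    congr 1
    exact RingHom.ext (map_incl e h)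
  rw [nestIdeal, Ideal.map_mul, Ideal.map_sup, Ideal.map_span, Ideal.map_span, h2]
  simp only [Set.image_singleton, map_add, map_X, map_incl]
  rfl

end Glue

/-! ### Ideals whose initial ideal is given by `stepSet` -/

section Step

variable {σ σ' : Type*} {e : Option σ' ≃ σ} {T : TailOrder σ} {A : Type*} [CommRing A]

theorem IsMonicAt.coeff_splitEquiv {f : MvPolynomial σ A} {b : ℕ}
    (hf : IsMonicAt T (glue e 0 b) f) {n : ℕ} (hn : b ≤ n) :
    (splitEquiv e A f).coeff n = if n = b then 1 else 0 := by
  classical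
  ext ν
  rw [Strata.coeff_splitEquiv]
  have h : coeff (glue e ν n) (f - monomial (glue e 0 b) 1) = 0 := by
    by_contra h
    exact absurd (TailOrder.lt_of_lt_glue (mem_restrictSupport_iff_coeff.mp hf _ h)) (not_lt.mpr hn)
  rw [coeff_sub, sub_eq_zero] at h
  rw [h, coeff_monomial]
  by_cases h1 : n = b
  · subst h1
    rw [if_pos rfl, coeff_one]
    exact if_congr ⟨fun h => (glue_injective e h).1, fun h => by rw [h]⟩ rfl rfl
  · rw [if_neg h1, if_neg fun h => h1 (glue_injective e h).2.symm, coeff_zero]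

theorem IsMonicAt.monic_splitEquiv {f : MvPolynomial σ A} {b : ℕ}
    (hf : IsMonicAt T (glue e 0 b) f) : (splitEquiv e A f).Monic := by
  refine Polynomial.monic_of_natDegree_le_of_coeff_eq_one b ?_ ?_
  · rw [Polynomial.natDegree_le_iff_coeff_eq_zero]
    intro n hn
    rw [hf.coeff_splitEquiv hn.le, if_neg hn.ne']
  · rw [hf.coeff_splitEquiv le_rfl, if_pos rfl]

theorem IsMonicAt.natDegree_splitEquiv [Nontrivial A] {f : MvPolynomial σ A} {b : ℕ}
    (hf : IsMonicAt T (glue e 0 b) f) : (splitEquiv e A f).natDegree = b := by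
  refine Polynomial.natDegree_eq_of_le_of_coeff_ne_zero ?_ ?_
  · rw [Polynomial.natDegree_le_iff_coeff_eq_zero]
    intro n hn
    rw [hf.coeff_splitEquiv hn.le, if_neg hn.ne']
  · rw [hf.coeff_splitEquiv le_rfl, if_pos rfl]
    exact one_ne_zero

theorem natDegree_splitEquiv_le {p : MvPolynomial σ A} {b : ℕ} {J₂ : Set (σ' →₀ ℕ)}
    (hp : p ∈ restrictSupport A (stepSet e b J₂)ᶜ) : (splitEquiv e A p).natDegree ≤ b := by
  rw [Polynomial.natDegree_le_iff_coeff_eq_zero]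
  intro n hn
  ext ν
  rw [coeff_splitEquiv, coeff_zero]
  by_contra h
  exact mem_restrictSupport_iff_coeff.mp hp _ h ((glue_mem_stepSet e).mpr (Or.inl hn))

theorem incl_mem_low {p : MvPolynomial σ' A} {s : Set (σ →₀ ℕ)}
    (hp : p ∈ restrictSupport A {ν | glue e ν 0 ∈ s}) : incl e A p ∈ restrictSupport A s := by
  rw [mem_restrictSupport_iff_coeff] at hp ⊢
  intro μ hμ
  rw [← glue_res e μ, coeff_glue_incl] at hμ
  split_ifs at hμ with h
  · have := hp _ hμ
    rwa [← h, Set.mem_ofPred_eq, glue_res] at this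
  · exact absurd rfl hμ

theorem IsMonicAt.incl {g : MvPolynomial σ' A} {ν : σ' →₀ ℕ} (hg : IsMonicAt (T.induced e) ν g) :
    IsMonicAt T (glue e ν 0) (incl e A g) := by
  have h : Strata.incl e A (monomial ν 1) = monomial (glue e ν 0) 1 := by
    classical
    ext μ
    rw [← glue_res e μ, coeff_glue_incl, coeff_monomial, coeff_monomial]
    by_cases h1 : μ (e none) = 0
    · rw [if_pos h1, h1]
      exact if_congr ⟨fun h => by rw [h], fun h => (glue_injective e h).1⟩ rfl rfl
    · rw [if_neg h1, if_neg fun h => h1 (glue_injective e h).2.symm]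
  rw [IsMonicAt, ← h, ← map_sub]
  exact incl_mem_low hg

theorem isMonicAt_X_add {l : MvPolynomial σ' A}
    (hl : l ∈ restrictSupport A {ν | T.lt (glue e ν 0) (glue e 0 1)}) :
    IsMonicAt T (glue e 0 1) (X (e none) + incl e A l) := by
  rw [IsMonicAt, monomial_glue_one, add_sub_cancel_left]
  exact incl_mem_low hl

theorem mem_nestIdeal_of {f : MvPolynomial σ A} {l : MvPolynomial σ' A}
    {I₂ : Ideal (MvPolynomial σ' A)} :
    f * (X (e none) + incl e A l) ∈ nestIdeal e f l I₂ ∧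
      ∀ g ∈ I₂, f * incl e A g ∈ nestIdeal e f l I₂ :=
  ⟨Ideal.mul_mem_mul (Ideal.mem_span_singleton_self _)
    (Submodule.mem_sup_left (Ideal.mem_span_singleton_self _)),
  fun _ hg => Ideal.mul_mem_mul (Ideal.mem_span_singleton_self _)
    (Submodule.mem_sup_right (Ideal.mem_map_of_mem _ hg))⟩

/-- Multiples of `f (x + l)` reach the exponents above `b` at `x`, and products `f g` with `g ∈ I₂`
those equal to `b`. An element supported outside has degree at most `b` in `x`, so it is `f c` with
`c ∈ I₂` supported outside `J₂`, and `c = 0`. -/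
theorem hasInitial_nestIdeal {b : ℕ} {J₂ : Set (σ' →₀ ℕ)} {f : MvPolynomial σ A}
    (hf : IsMonicAt T (glue e 0 b) f) {l : MvPolynomial σ' A}
    (hl : l ∈ restrictSupport A {ν | T.lt (glue e ν 0) (glue e 0 1)})
    {I₂ : Ideal (MvPolynomial σ' A)} (hI₂ : HasInitial (T.induced e) J₂ I₂) :
    HasInitial T (stepSet e b J₂) (nestIdeal e f l I₂) := by
  rcases subsingleton_or_nontrivial A with hA | hA
  · refine ⟨fun α _ => ⟨0, zero_mem _, ?_⟩, fun _ _ _ => Subsingleton.elim _ _⟩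
    rw [IsMonicAt, Subsingleton.elim (0 - _ : MvPolynomial σ A) 0]
    exact zero_mem _
  constructor
  · intro μ hμ
    rw [← glue_res e μ, glue_mem_stepSet] at hμ
    rcases hμ with hμ | ⟨hμ, hν⟩
    · obtain ⟨n, hn⟩ : ∃ n, μ (e none) = n + (b + 1) := ⟨μ (e none) - (b + 1), by omega⟩
      refine ⟨_, Ideal.mul_mem_left _ (monomial (glue e (res e μ) n) 1) mem_nestIdeal_of.1, ?_⟩
      have := (isMonicAt_monomial (T := T) (A := A) (glue e (res e μ) n)).mul
        (hf.mul (isMonicAt_X_add hl))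
      rwa [← glue_add, ← glue_add, add_zero, add_zero, ← hn, glue_res] at this
    · obtain ⟨g, hg, hgm⟩ := hI₂.exists_monic _ hν
      refine ⟨_, mem_nestIdeal_of.2 g hg, ?_⟩
      have := hf.mul hgm.incl
      rwa [← glue_add, zero_add, add_zero, ← hμ, glue_res] at this
  · intro p hp hpJ
    have h1 := exists_of_mem_nest hf.monic_splitEquiv hf.natDegree_splitEquiv
      ((mem_nestIdeal e _).mp ((mem_map_splitEquiv e).mpr hp)) (natDegree_splitEquiv_le hpJ)
    have h2 : (splitEquiv e A p).coeff b = 0 := by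
      refine hI₂.eq_zero _ h1.1 ?_
      rw [mem_restrictSupport_iff_coeff]
      intro ν hν hνJ
      rw [coeff_splitEquiv] at hν
      exact mem_restrictSupport_iff_coeff.mp hpJ _ hν
        ((glue_mem_stepSet e).mpr (Or.inr ⟨rfl, hνJ⟩))
    apply (splitEquiv e A).injective
    rw [h1.2, h2]
    simp

theorem HasInitial.exists_regular {J₂ : Set (σ' →₀ ℕ)} {T' : TailOrder σ'}
    {I₂ : Ideal (MvPolynomial σ' A)} (hI₂ : HasInitial T' J₂ I₂) (hJ₂ : J₂.Nonempty) :
    ∃ α ∈ J₂, ∃ g ∈ I₂, IsReducedAt T' J₂ α g ∧ ∀ r, r * g = 0 → r = 0 := by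
  obtain ⟨α, hα⟩ := hJ₂
  obtain ⟨g, hg, hm⟩ := hI₂.exists_isReducedAt hα
  exact ⟨α, hα, g, hg, hm, fun r => hm.isMonicAt.eq_zero_of_mul⟩

theorem nestIdeal_injective {b : ℕ} {J₂ : Set (σ' →₀ ℕ)} (hJ₂ : J₂.Nonempty)
    {f f' : MvPolynomial σ A} (hf : IsMonicAt T (glue e 0 b) f)
    (hf' : IsMonicAt T (glue e 0 b) f') {l l' : MvPolynomial σ' A}
    (hl : l ∈ restrictSupport A J₂ᶜ) (hl' : l' ∈ restrictSupport A J₂ᶜ)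
    {I₂ I₂' : Ideal (MvPolynomial σ' A)} (hI₂ : HasInitial (T.induced e) J₂ I₂)
    (h : nestIdeal e f l I₂ = nestIdeal e f' l' I₂') : f = f' ∧ l = l' ∧ I₂ = I₂' := by
  rcases subsingleton_or_nontrivial A with hA | hA
  · exact ⟨Subsingleton.elim _ _, Subsingleton.elim _ _, Subsingleton.elim _ _⟩
  obtain ⟨α, hα, g, hg, -, hg0⟩ := hI₂.exists_regular hJ₂
  obtain ⟨h1, h2, h3⟩ := nest_injective hf.monic_splitEquiv hf'.monic_splitEquiv
    hf.natDegree_splitEquiv hf'.natDegree_splitEquiv (mem_nestIdeal e)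
    (fun P => by rw [h, mem_nestIdeal]) hg hg0
  exact ⟨(splitEquiv e A).injective h2, sub_eq_zero.mp (hI₂.eq_zero _ h3 (sub_mem hl hl')), h1⟩

theorem nestIdeal_congr {f : MvPolynomial σ A} {l l' : MvPolynomial σ' A}
    {I₂ : Ideal (MvPolynomial σ' A)} (h : l - l' ∈ I₂) :
    nestIdeal e f l I₂ = nestIdeal e f l' I₂ := by
  ext p
  rw [← mem_map_splitEquiv e, ← mem_map_splitEquiv e, mem_nestIdeal, mem_nestIdeal, nest_congr h]

theorem hasScalarEnd_nestIdeal {b : ℕ} {J₂ : Set (σ' →₀ ℕ)} (hJ₂ : J₂.Nonempty)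
    {f : MvPolynomial σ A} (hf : IsMonicAt T (glue e 0 b) f) {l : MvPolynomial σ' A}
    {I₂ : Ideal (MvPolynomial σ' A)} (hI₂ : HasInitial (T.induced e) J₂ I₂) :
    HasScalarEnd (nestIdeal e f l I₂) := by
  obtain ⟨α, hα, g, hg, -, hg0⟩ := hI₂.exists_regular hJ₂
  exact HasScalarEnd.of_ringEquiv (splitEquiv e A) (fun p => mem_map_splitEquiv e)
    (hasScalarEnd_nest hf.monic_splitEquiv (mem_nestIdeal e) hg hg0)

/-- The univariate factorization `exists_nest` supplies `f` and `l` but controls only degrees in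
`x`. The bounds for the term order follow by cancelling monic factors. -/
theorem HasInitial.exists_nestIdeal {b : ℕ} {J₂ : Set (σ' →₀ ℕ)} (hJ₂ : J₂.Nonempty)
    (hend : ∀ I₂ : Ideal (MvPolynomial σ' A), HasInitial (T.induced e) J₂ I₂ → HasScalarEnd I₂)
    {I : Ideal (MvPolynomial σ A)} (hI : HasInitial T (stepSet e b J₂) I) :
    ∃ f l I₂, IsMonicAt T (glue e 0 b) f ∧
      l ∈ restrictSupport A {ν | T.lt (glue e ν 0) (glue e 0 1) ∧ ν ∉ J₂} ∧
      HasInitial (T.induced e) J₂ I₂ ∧ I = nestIdeal e f l I₂ := by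
  rcases subsingleton_or_nontrivial A with hA | hA
  · refine ⟨0, 0, ⊤, ?_, zero_mem _, ⟨fun α _ => ⟨0, zero_mem _, ?_⟩,
      fun _ _ _ => Subsingleton.elim _ _⟩, Subsingleton.elim _ _⟩
    · rw [IsMonicAt, Subsingleton.elim (0 - _ : MvPolynomial σ A) 0]
      exact zero_mem _
    · rw [IsMonicAt, Subsingleton.elim (0 - _ : MvPolynomial σ' A) 0]
      exact zero_mem _
  set I' := I.map (splitEquiv e A) with hI'
  have hmem : ∀ p, splitEquiv e A p ∈ I' ↔ p ∈ I := fun p => mem_map_splitEquiv e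
  obtain ⟨F, hFI, hF⟩ := hI.exists_isReducedAt (α := glue e 0 (b + 1))
    ((glue_mem_stepSet e).mpr (Or.inl (by omega)))
  -- In degree at most `b`, only the coefficient at `x^b` can meet the initial ideal. The set `D`
  -- will be `J₂ᶜ` to find the initial ideal of the leading ideal, and `∅` to see that the leading
  -- coefficient determines the element.
  have hinj : ∀ p ∈ I', p.natDegree ≤ b → ∀ D : Set (σ' →₀ ℕ), D ⊆ J₂ᶜ →
      p.coeff b ∈ restrictSupport A D → p = 0 := by
    intro P hP hd D hD hPD
    obtain ⟨p, rfl⟩ := (splitEquiv e A).surjective P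
    rw [hI.eq_zero p ((hmem p).mp hP) ?_, map_zero]
    rw [mem_restrictSupport_iff_coeff]
    intro μ hμ hμJ
    rw [← glue_res e μ, glue_mem_stepSet] at hμJ
    rw [← glue_res e μ, ← coeff_splitEquiv] at hμ
    rcases hμJ with h | ⟨h, h'⟩
    · rw [Polynomial.coeff_eq_zero_of_natDegree_lt (lt_of_le_of_lt hd h), coeff_zero] at hμ
      exact hμ rfl
    · rw [h] at hμ
      exact hD (mem_restrictSupport_iff_coeff.mp hPD _ hμ) h'
  have hlead : ∀ α ∈ J₂, ∃ p ∈ I, IsMonicAt T (glue e α b) p ∧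
      (splitEquiv e A p).natDegree ≤ b ∧
      IsMonicAt (T.induced e) α ((splitEquiv e A p).coeff b) := by
    intro α hα
    obtain ⟨p, hp, hpr⟩ := hI.exists_isReducedAt (α := glue e α b)
      ((glue_mem_stepSet e).mpr (Or.inr ⟨rfl, hα⟩))
    refine ⟨p, hp, hpr.isMonicAt, ?_, ?_⟩
    · rw [← sub_add_cancel p (monomial (glue e α b) 1), map_add]
      refine (Polynomial.natDegree_add_le_of_degree_le (natDegree_splitEquiv_le
        (restrictSupport_mono _ Set.inter_subset_right hpr)) ?_)
      -- The monomial itself lies in the step set of `J₂`; with `∅` instead, the lemma still bounds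
      -- its degree.
      refine natDegree_splitEquiv_le (J₂ := ∅) ?_
      simp [glue_mem_stepSet]
    · rw [IsMonicAt, mem_restrictSupport_iff_coeff]
      intro ν hν
      have h1 : coeff ν ((splitEquiv e A p).coeff b - monomial α 1) =
          coeff (glue e ν b) (p - monomial (glue e α b) 1) := by
        classical
        rw [coeff_sub, coeff_sub, coeff_splitEquiv, coeff_monomial, coeff_monomial]
        congr 1
        exact if_congr ⟨fun h => by rw [h], fun h => (glue_injective e h).1⟩ rfl rfl
      rw [h1] at hν
      exact (TailOrder.lt_glue_iff b).mp (mem_restrictSupport_iff_coeff.mp hpr.isMonicAt _ hν)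
  have hI₂ : HasInitial (T.induced e) J₂ (leadIdeal I' b) := by
    constructor
    · intro α hα
      obtain ⟨p, hp, -, hd, hm⟩ := hlead α hα
      exact ⟨_, ⟨_, (hmem p).mpr hp, hd, rfl⟩, hm⟩
    · rintro _ ⟨P, hP, hd, rfl⟩ hPJ
      rw [hinj P hP hd _ subset_rfl hPJ, Polynomial.coeff_zero]
  obtain ⟨α, hα⟩ := hJ₂
  obtain ⟨p, hp, hpm, hpd, hm⟩ := hlead α hα
  obtain ⟨f', l, hf'm, hf'd, hFf, hnest⟩ := exists_nest ((hmem F).mpr hFI)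
    hF.isMonicAt.monic_splitEquiv hF.isMonicAt.natDegree_splitEquiv
    (fun P hP hd h0 => hinj P hP hd ∅ (Set.empty_subset _) (h0 ▸ zero_mem _))
    ⟨_, (hmem p).mpr hp, hpd, rfl⟩ (fun r => hm.eq_zero_of_mul) (hend _ hI₂)
  obtain ⟨f, rfl⟩ := (splitEquiv e A).surjective f'
  have hpf : p = f * incl e A ((splitEquiv e A p).coeff b) := by
    apply (splitEquiv e A).injective
    rw [map_mul, splitEquiv_incl]
    exact (exists_of_mem_nest hf'm hf'd ((hnest _).mp ((hmem p).mpr hp)) hpd).2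
  -- Both `p` and its leading coefficient are monic for the order, and `p` is the product of `f`
  -- with that coefficient.
  have hfm : IsMonicAt T (glue e 0 b) f := by
    refine hm.incl.mem_low_of_mul ?_
    rw [sub_mul, ← hpf, ← glue_add, zero_add, add_zero]
    have h1 := (isMonicAt_monomial (T := T) (A := A) (glue e 0 b)).mul hm.incl
    rw [← glue_add, zero_add, add_zero] at h1
    have h2 := sub_mem hpm h1
    rwa [sub_sub_sub_cancel_right] at h2
  have hFf' : F = f * (X (e none) + incl e A l) := by
    apply (splitEquiv e A).injective
    rw [hFf, map_mul, map_add, splitEquiv_X, splitEquiv_incl]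
  -- Likewise from `F = f (x + l)`, where `F` is monic at `x^(b + 1)` and `f` at `x^b`.
  have hl : incl e A l ∈ restrictSupport A (T.low (glue e 0 1)) := by
    refine hfm.mem_low_of_mul ?_
    have h1 := (isMonicAt_monomial (T := T) (A := A) (glue e 0 1)).mul hfm
    rw [← glue_add, zero_add, add_comm 1] at h1 ⊢
    have h2 := sub_mem hF.isMonicAt h1
    rwa [sub_sub_sub_cancel_right, hFf', monomial_glue_one, mul_comm f, add_mul,
      add_sub_cancel_left] at h2
  have hl' : l ∈ restrictSupport A {ν | T.lt (glue e ν 0) (glue e 0 1)} := by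
    rw [mem_restrictSupport_iff_coeff] at hl ⊢
    intro ν hν
    refine hl _ ?_
    rwa [coeff_glue_incl, if_pos rfl]
  -- The ideal depends on `l` only modulo `I₂`, so `l` may be replaced by its normal form.
  obtain ⟨l', hl'', hll⟩ := exists_normalForm hI₂.exists_monic
    (fun β hβ γ hγ => T.trans hγ hβ) hl'
  refine ⟨f, l', _, hfm, hl'', hI₂, ?_⟩
  rw [← nestIdeal_congr hll]
  ext q
  rw [← hmem, hnest, ← mem_map_splitEquiv e, mem_nestIdeal]

end Step

end Strata

/-! ### Parametrization by affine spaces -/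

namespace Strata

open MvPolynomial

universe u

/-- A natural parametrization, by affine spaces, of the ideals with initial ideal `J`. -/
structure Parametrization {σ : Type} (T : TailOrder σ) (J : Set (σ →₀ ℕ)) where
  /-- The index set of the parameters. -/
  index : Type
  finite : Finite index
  /-- The ideal with given parameters. -/
  toIdeal : ∀ {A : Type u} [CommRing A], (index → A) → Ideal (MvPolynomial σ A)
  hasInitial : ∀ {A : Type u} [CommRing A] (v : index → A), HasInitial T J (toIdeal v)
  injective : ∀ {A : Type u} [CommRing A],
    Function.Injective (toIdeal : (index → A) → Ideal (MvPolynomial σ A))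
  surjective : ∀ {A : Type u} [CommRing A] (I : Ideal (MvPolynomial σ A)), HasInitial T J I →
    ∃ v, toIdeal v = I
  map_toIdeal : ∀ {A B : Type u} [CommRing A] [CommRing B] (h : A →+* B) (v : index → A),
    (toIdeal v).map (MvPolynomial.map h) = toIdeal (h ∘ v)

/-- All ideals with initial ideal `J` have only scalar endomorphisms. -/
def IsRigid {σ : Type} (T : TailOrder σ) (J : Set (σ →₀ ℕ)) : Prop :=
  ∀ (A : Type u) [CommRing A] (I : Ideal (MvPolynomial σ A)), HasInitial T J I → HasScalarEnd I

section Basic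

variable {σ : Type} (T : TailOrder σ) {A : Type u} [CommRing A]

theorem hasInitial_univ_iff {I : Ideal (MvPolynomial σ A)} : HasInitial T Set.univ I ↔ I = ⊤ := by
  constructor
  · intro h
    obtain ⟨F, hF, hF'⟩ := h.exists_isReducedAt (Set.mem_univ 0)
    have : F - monomial 0 1 = 0 := by
      simpa [IsReducedAt, mem_restrictSupport_iff] using hF'
    rw [sub_eq_zero] at this
    rw [Ideal.eq_top_iff_one]
    simpa [this] using hF
  · rintro rfl
    refine ⟨fun α _ => ⟨_, Submodule.mem_top, isMonicAt_monomial α⟩, fun f _ hf => ?_⟩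
    simpa [mem_restrictSupport_iff] using hf

theorem hasInitial_empty_iff {I : Ideal (MvPolynomial σ A)} : HasInitial T ∅ I ↔ I = ⊥ := by
  constructor
  · intro h
    rw [eq_bot_iff]
    intro f hf
    exact h.eq_zero f hf (by simp)
  · rintro rfl
    exact ⟨fun α hα => hα.elim, fun f hf _ => hf⟩

/-- Only the unit ideal has the unit ideal as initial ideal. -/
noncomputable def Parametrization.univ : Parametrization.{u} T Set.univ where
  index := Empty
  finite := inferInstance
  toIdeal _ := ⊤
  hasInitial _ := (hasInitial_univ_iff T).mpr rfl
  injective := fun _ => Subsingleton.elim _ _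
  surjective _ hI := ⟨Empty.elim, ((hasInitial_univ_iff T).mp hI).symm⟩
  map_toIdeal _ _ := Ideal.map_top _

/-- Only the zero ideal has the zero ideal as initial ideal. -/
noncomputable def Parametrization.empty : Parametrization.{u} T ∅ where
  index := Empty
  finite := inferInstance
  toIdeal _ := ⊥
  hasInitial _ := (hasInitial_empty_iff T).mpr rfl
  injective := fun _ => Subsingleton.elim _ _
  surjective _ hI := ⟨Empty.elim, ((hasInitial_empty_iff T).mp hI).symm⟩
  map_toIdeal _ _ := Ideal.map_bot

end Basic

section Step

variable {σ σ' : Type} {e : Option σ' ≃ σ} {T : TailOrder σ} {b : ℕ} {J₂ : Set (σ' →₀ ℕ)}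

variable (e T J₂) in
/-- The monomials, outside `J₂` and not involving the distinguished variable, that are smaller
than it. -/
def lowVar : Set (σ' →₀ ℕ) := {ν | T.lt (glue e ν 0) (glue e 0 1) ∧ ν ∉ J₂}

theorem finite_lowVar : (lowVar e T J₂).Finite :=
  ((T.finite (glue e 0 1)).preimage (f := fun ν => glue e ν 0)
    fun _ _ _ _ h => (glue_injective e h).1).subset fun _ h => h.1

noncomputable instance (α : σ →₀ ℕ) : Fintype (T.low α) := (T.finite α).fintype

noncomputable instance : Fintype (lowVar e T J₂) := finite_lowVar.fintype

variable {A : Type*} [CommRing A]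

theorem isMonicAt_monomial_add_polyOf {α : σ →₀ ℕ} (v : T.low α → A) :
    IsMonicAt T α (monomial α 1 + polyOf v) := by
  rw [IsMonicAt, add_sub_cancel_left]
  exact polyOf_mem v

theorem polyOf_lowVar_mem_low (v : lowVar e T J₂ → A) :
    polyOf v ∈ restrictSupport A {ν | T.lt (glue e ν 0) (glue e 0 1)} :=
  restrictSupport_mono _ (fun _ h => h.1) (polyOf_mem v)

theorem polyOf_lowVar_mem_compl (v : lowVar e T J₂ → A) :
    polyOf v ∈ restrictSupport A J₂ᶜ :=
  restrictSupport_mono _ (fun _ h => h.2) (polyOf_mem v)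

variable (b) in
/-- The parametrization of the ideals `f (x + l, I₂)` by the coefficients of `f` and `l` and the
parameters of `I₂`. -/
noncomputable def Parametrization.step (P : Parametrization.{u} (T.induced e) J₂)
    (hJ₂ : J₂.Nonempty) (hr : IsRigid.{u} (T.induced e) J₂) :
    Parametrization.{u} T (stepSet e b J₂) where
  index := T.low (glue e 0 b) ⊕ lowVar e T J₂ ⊕ P.index
  finite := by
    have := P.finite
    infer_instance
  toIdeal v := nestIdeal e (monomial (glue e 0 b) 1 + polyOf (v ∘ Sum.inl))
    (polyOf (v ∘ Sum.inr ∘ Sum.inl)) (P.toIdeal (v ∘ Sum.inr ∘ Sum.inr))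
  hasInitial v := hasInitial_nestIdeal (isMonicAt_monomial_add_polyOf _)
    (polyOf_lowVar_mem_low _) (P.hasInitial _)
  injective := by
    intro _ _ v w h
    obtain ⟨h1, h2, h3⟩ := nestIdeal_injective hJ₂ (isMonicAt_monomial_add_polyOf _)
      (isMonicAt_monomial_add_polyOf _) (polyOf_lowVar_mem_compl _) (polyOf_lowVar_mem_compl _)
      (P.hasInitial _) h
    have h1 := polyOf_injective (add_left_cancel h1)
    have h2 := polyOf_injective h2
    have h3 := P.injective h3
    funext i
    rcases i with i | i | i
    · exact congrFun h1 i
    · exact congrFun h2 i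
    · exact congrFun h3 i
  surjective I hI := by
    obtain ⟨f, l, I₂, hf, hl, hI₂, rfl⟩ := hI.exists_nestIdeal hJ₂ (hr _)
    obtain ⟨v₁, hv₁⟩ := exists_polyOf hf
    obtain ⟨v₂, hv₂⟩ := exists_polyOf (s := lowVar e T J₂) hl
    obtain ⟨v₃, hv₃⟩ := P.surjective I₂ hI₂
    refine ⟨Sum.elim v₁ (Sum.elim v₂ v₃), ?_⟩
    simp only [← Function.comp_assoc, Sum.elim_comp_inl, Sum.elim_comp_inr, hv₁, hv₂, hv₃]
    rw [add_sub_cancel]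
  map_toIdeal h v := by
    rw [nestIdeal_map, map_add, map_monomial, map_polyOf, map_polyOf, P.map_toIdeal, map_one]
    simp only [Function.comp_assoc]

theorem IsRigid.step (hJ₂ : J₂.Nonempty) (hr : IsRigid.{u} (T.induced e) J₂) :
    IsRigid.{u} T (stepSet e b J₂) := by
  intro A _ I hI
  obtain ⟨f, l, I₂, hf, hl, hI₂, rfl⟩ := hI.exists_nestIdeal hJ₂ (hr _)
  exact hasScalarEnd_nestIdeal hJ₂ hf hI₂

end Step

/-- The exponents whose components at the variables `p 0, p 1, …` are lexicographically at
least `b`. -/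
def lexSet {σ : Type} {r : ℕ} (p : Fin r → σ) (b : Fin r → ℕ) : Set (σ →₀ ℕ) :=
  {μ | toLex b ≤ toLex fun j => μ (p j)}

theorem toLex_le_succ_iff {r : ℕ} (b c : Fin (r + 1) → ℕ) : toLex b ≤ toLex c ↔
    b 0 < c 0 ∨ c 0 = b 0 ∧ toLex (fun j : Fin r => b j.succ) ≤ toLex fun j : Fin r => c j.succ := by
  have hlt : toLex b < toLex c ↔ b 0 < c 0 ∨ b 0 = c 0 ∧
      toLex (fun j : Fin r => b j.succ) < toLex fun j : Fin r => c j.succ := by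
    have := Fin.pi_lex_lt_cons_cons (x₀ := b 0) (y₀ := c 0) (x := fun j : Fin r => b j.succ)
      (y := fun j : Fin r => c j.succ) (fun {_ : Fin (r + 1)} (m n : ℕ) => m < n)
    rw [show (Fin.cons (b 0) (fun j : Fin r => b j.succ) : Fin (r + 1) → ℕ) = b from
      Fin.cons_self_tail b, show (Fin.cons (c 0) (fun j : Fin r => c j.succ) : Fin (r + 1) → ℕ) = c
      from Fin.cons_self_tail c] at this
    exact this
  have heq : toLex b = toLex c ↔ b 0 = c 0 ∧
      toLex (fun j : Fin r => b j.succ) = toLex fun j : Fin r => c j.succ := by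
    simp only [EmbeddingLike.apply_eq_iff_eq, _root_.funext_iff, Fin.forall_fin_succ]
  have hle : toLex (fun j : Fin r => b j.succ) ≤ (toLex fun j : Fin r => c j.succ) ↔
      toLex (fun j : Fin r => b j.succ) < (toLex fun j : Fin r => c j.succ) ∨
      toLex (fun j : Fin r => b j.succ) = toLex fun j : Fin r => c j.succ := le_iff_lt_or_eq
  refine le_iff_lt_or_eq.trans ((or_congr hlt heq).trans ?_)
  rw [hle, eq_comm (a := c 0)]
  tauto

/-- The induction on `r` quantifies over all variable sets and orders, because removing the variable
`p 0` replaces `T` by the induced order. Nonemptiness and rigidity are carried along because the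
next step consumes them. With no listed variable left, the only ideal is the unit ideal. -/
theorem exists_parametrization_lexSet {r : ℕ} : ∀ {σ : Type} (T : TailOrder σ) {p : Fin r → σ},
    Function.Injective p → ∀ b : Fin r → ℕ, (lexSet p b).Nonempty ∧
      IsRigid.{u} T (lexSet p b) ∧ Nonempty (Parametrization.{u} T (lexSet p b)) := by
  classical
  induction r with
  | zero =>
    intro σ T p _ b
    have h : lexSet p b = Set.univ := Set.eq_univ_of_forall fun μ =>
      show toLex b ≤ _ from le_of_eq (congrArg toLex (Subsingleton.elim _ _))
    rw [h]
    refine ⟨Set.univ_nonempty, fun A _ I hI => ?_, ⟨Parametrization.univ T⟩⟩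
    rw [(hasInitial_univ_iff T).mp hI]
    exact hasScalarEnd_top
  | succ r ih =>
    intro σ T p hp b
    set e : Option {j // j ≠ p 0} ≃ σ := Equiv.optionSubtypeNe (p 0)
    set p' : Fin r → {j // j ≠ p 0} := fun j => ⟨p j.succ, hp.ne (Fin.succ_ne_zero j)⟩ with hp'
    have h : lexSet p b = stepSet e (b 0) (lexSet p' fun j => b j.succ) := by
      ext μ
      exact toLex_le_succ_iff b fun j => μ (p j)
    obtain ⟨h1, h2, ⟨P⟩⟩ := ih (T.induced e) (p := p')
      (fun i j hij => Fin.succ_injective _ (hp (Subtype.ext_iff.mp hij))) fun j => b j.succ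
    rw [h]
    exact ⟨⟨glue e 0 (b 0 + 1), (glue_mem_stepSet e).mpr (Or.inl (by omega))⟩,
      IsRigid.step h1 h2, ⟨P.step (b 0) h1 h2⟩⟩

end Strata

namespace Strata

open MvPolynomial AlgebraicGeometry CategoryTheory

universe u w

/-! ### Buchberger's criterion over a ring -/

noncomputable section Buchberger

variable {σ : Type} {A : Type*} [CommRing A] (m : MonomialOrder.{0, w} σ) {B : Set (σ →₀ ℕ)}
  (F : B → MvPolynomial σ A)

/-- The combinations of the multiples `X^γ F_α` whose leading exponents satisfy `P`. -/
def multiples (P : m.syn → Prop) : Submodule A (MvPolynomial σ A) :=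
  Submodule.span A {p | ∃ (α : B) (γ : σ →₀ ℕ), P (m.toSyn (γ + α.1)) ∧ p = monomial γ 1 * F α}

variable {m F}

theorem mem_multiples {P : m.syn → Prop} {α : B} {γ : σ →₀ ℕ} (h : P (m.toSyn (γ + α.1))) :
    monomial γ 1 * F α ∈ multiples m F P :=
  Submodule.subset_span ⟨α, γ, h, rfl⟩

theorem multiples_mono {P Q : m.syn → Prop} (h : ∀ d, P d → Q d) :
    multiples m F P ≤ multiples m F Q :=
  Submodule.span_mono fun _ ⟨α, γ, hP, hp⟩ => ⟨α, γ, h _ hP, hp⟩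

theorem monomial_mul_mem_multiples {P Q : m.syn → Prop} {γ : σ →₀ ℕ}
    (h : ∀ d, P d → Q (m.toSyn γ + d)) {p : MvPolynomial σ A} (hp : p ∈ multiples m F P) :
    monomial γ 1 * p ∈ multiples m F Q := by
  induction hp using Submodule.span_induction with
  | mem x hx =>
    obtain ⟨α, δ, hP, rfl⟩ := hx
    rw [← mul_assoc, monomial_mul, one_mul]
    refine mem_multiples ?_
    rw [add_assoc, map_add]
    exact h _ hP
  | zero => simp
  | add x y _ _ hx hy => rw [mul_add]; exact add_mem hx hy
  | smul a x _ hx => rw [mul_smul_comm]; exact Submodule.smul_mem _ _ hx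

theorem eq_zero_or_of_mem_multiples_lt {d : m.syn} {p : MvPolynomial σ A}
    (hp : p ∈ multiples m F (· < d)) : p = 0 ∨ ∃ d' < d, p ∈ multiples m F (· ≤ d') := by
  induction hp using Submodule.span_induction with
  | mem x hx =>
    obtain ⟨α, γ, hP, rfl⟩ := hx
    exact Or.inr ⟨_, hP, mem_multiples le_rfl⟩
  | zero => exact Or.inl rfl
  | add x y _ _ hx hy =>
    rcases hx with rfl | ⟨d₁, hd₁, hx⟩
    · rwa [zero_add]
    rcases hy with rfl | ⟨d₂, hd₂, hy⟩
    · rw [add_zero]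
      exact Or.inr ⟨d₁, hd₁, hx⟩
    exact Or.inr ⟨max d₁ d₂, max_lt hd₁ hd₂,
      add_mem (multiples_mono (fun d h => h.trans (le_max_left _ _)) hx)
        (multiples_mono (fun d h => h.trans (le_max_right _ _)) hy)⟩
  | smul a x _ hx =>
    rcases hx with rfl | ⟨d', hd', hx⟩
    · exact Or.inl (smul_zero a)
    · exact Or.inr ⟨d', hd', Submodule.smul_mem _ _ hx⟩

theorem exists_mem_multiples {p : MvPolynomial σ A} (hp : p ∈ Ideal.span (Set.range F)) :
    ∃ d, p ∈ multiples m F (· ≤ d) := by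
  induction hp using Submodule.span_induction with
  | mem x hx =>
    obtain ⟨α, rfl⟩ := hx
    refine ⟨m.toSyn (0 + α.1), ?_⟩
    simpa using mem_multiples (F := F) (P := (· ≤ m.toSyn (0 + α.1))) (α := α) (γ := 0) le_rfl
  | zero => exact ⟨0, zero_mem _⟩
  | add x y _ _ hx hy =>
    obtain ⟨d₁, hx⟩ := hx
    obtain ⟨d₂, hy⟩ := hy
    exact ⟨max d₁ d₂, add_mem (multiples_mono (fun d h => h.trans (le_max_left _ _)) hx)
        (multiples_mono (fun d h => h.trans (le_max_right _ _)) hy)⟩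
  | smul q x _ hx =>
    obtain ⟨d, hx⟩ := hx
    induction q using MvPolynomial.induction_on' with
    | monomial γ a =>
      refine ⟨m.toSyn γ + d, ?_⟩
      rw [show monomial γ a = a • monomial γ (1 : A) by simp [smul_monomial], smul_assoc]
      exact Submodule.smul_mem _ _ (monomial_mul_mem_multiples (fun _ h => by gcongr) hx)
    | add p q hp hq =>
      obtain ⟨d₁, hp⟩ := hp
      obtain ⟨d₂, hq⟩ := hq
      rw [add_smul]
      exact ⟨max d₁ d₂, add_mem (multiples_mono (fun d h => h.trans (le_max_left _ _)) hp)
        (multiples_mono (fun d h => h.trans (le_max_right _ _)) hq)⟩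

/-- Two multiples with the same leading exponent differ by a monomial multiple of the
`S`-polynomial, since that exponent lies above the least common multiple. -/
theorem sub_mem_multiples_of_sPoly
    (hS : ∀ α β : B, monomial (α.1 ⊔ β.1 - α.1) 1 * F α - monomial (α.1 ⊔ β.1 - β.1) 1 * F β ∈
      multiples m F (· < m.toSyn (α.1 ⊔ β.1))) {α β : B} {γ δ : σ →₀ ℕ}
    (h : γ + α.1 = δ + β.1) : monomial γ 1 * F α - monomial δ 1 * F β ∈
      multiples m F (· < m.toSyn (γ + α.1)) := by
  obtain ⟨ε, hε⟩ : ∃ ε, γ + α.1 = ε + (α.1 ⊔ β.1) := by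
    obtain ⟨ε, hε⟩ := le_iff_exists_add'.mp
      (sup_le (le_add_self : α.1 ≤ γ + α.1) (h ▸ le_add_self : β.1 ≤ γ + α.1))
    exact ⟨ε, hε⟩
  have h1 : γ = ε + (α.1 ⊔ β.1 - α.1) := by
    apply add_right_cancel (b := α.1)
    rw [hε, add_assoc, tsub_add_cancel_of_le le_sup_left]
  have h2 : δ = ε + (α.1 ⊔ β.1 - β.1) := by
    apply add_right_cancel (b := β.1)
    rw [← h, hε, add_assoc, tsub_add_cancel_of_le le_sup_right]
  have := monomial_mul_mem_multiples (Q := (· < m.toSyn (γ + α.1))) (γ := ε) (fun d hd => by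
    rw [hε, map_add]
    gcongr) (hS α β)
  rwa [mul_sub, ← mul_assoc, ← mul_assoc, monomial_mul, monomial_mul, one_mul, ← h1, ← h2] at this

/-- All multiples with leading exponent exactly `d` can be exchanged for a single one, modulo
combinations with smaller leading exponents. -/
theorem mem_multiples_le
    (hS : ∀ α β : B, monomial (α.1 ⊔ β.1 - α.1) 1 * F α - monomial (α.1 ⊔ β.1 - β.1) 1 * F β ∈
      multiples m F (· < m.toSyn (α.1 ⊔ β.1))) {d : m.syn} {p : MvPolynomial σ A}
    (hp : p ∈ multiples m F (· ≤ d)) : p ∈ multiples m F (· < d) ∨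
      ∃ (α : B) (γ : σ →₀ ℕ) (a : A), m.toSyn (γ + α.1) = d ∧
        p - a • (monomial γ 1 * F α) ∈ multiples m F (· < d) := by
  induction hp using Submodule.span_induction with
  | mem x hx =>
    obtain ⟨α, γ, hP, rfl⟩ := hx
    rcases hP.lt_or_eq with h | h
    · exact Or.inl (mem_multiples h)
    · exact Or.inr ⟨α, γ, 1, h, by simp⟩
  | zero => exact Or.inl (zero_mem _)
  | add x y _ _ hx hy =>
    rcases hx with hx | ⟨α, γ, a, h, hx⟩
    · rcases hy with hy | ⟨α, γ, a, h, hy⟩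
      · exact Or.inl (add_mem hx hy)
      · exact Or.inr ⟨α, γ, a, h, by rw [add_sub_assoc]; exact add_mem hx hy⟩
    · rcases hy with hy | ⟨β, δ, b, h', hy⟩
      · exact Or.inr ⟨α, γ, a, h, by rw [add_sub_right_comm]; exact add_mem hx hy⟩
      · refine Or.inr ⟨α, γ, a + b, h, ?_⟩
        have h3 := sub_mem_multiples_of_sPoly hS (m.toSyn.injective (h.trans h'.symm))
        rw [h] at h3
        have := sub_mem (add_mem hx hy) (Submodule.smul_mem _ b h3)
        convert this using 1
        rw [smul_sub, add_smul]
        abel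
  | smul c x _ hx =>
    rcases hx with hx | ⟨α, γ, a, h, hx⟩
    · exact Or.inl (Submodule.smul_mem _ _ hx)
    · refine Or.inr ⟨α, γ, c * a, h, ?_⟩
      rw [mul_smul, ← smul_sub]
      exact Submodule.smul_mem _ _ hx

variable {T : TailOrder σ}

theorem monomial_mul_mem_of_isMonicAt (hT : ∀ α, T.low α ⊆ tail m α) {α γ : σ →₀ ℕ}
    {f : MvPolynomial σ A} (hf : IsMonicAt T α f) (a : A) :
    monomial γ a * f ∈ restrictSupport A {μ | m.toSyn μ ≤ m.toSyn (γ + α)} := by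
  rw [← sub_add_cancel f (monomial α 1), mul_add]
  refine add_mem ?_ ?_
  · exact restrictSupport_mono _ (fun μ hμ => (hT _ hμ).le) (monomial_mul_mem_low hf γ a)
  · rw [monomial_mul, monomial_mem_restrictSupport]
    exact Or.inl le_rfl

/-- Buchberger's criterion for families of monic polynomials. -/
theorem eq_zero_of_sPoly (hT : ∀ α, T.low α ⊆ tail m α) (hF : ∀ α, IsMonicAt T α.1 (F α))
    (hS : ∀ α β : B, monomial (α.1 ⊔ β.1 - α.1) 1 * F α - monomial (α.1 ⊔ β.1 - β.1) 1 * F β ∈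
      multiples m F (· < m.toSyn (α.1 ⊔ β.1))) {J : Set (σ →₀ ℕ)}
    (hJ : ∀ (α : B) γ, γ + α.1 ∈ J) {p : MvPolynomial σ A} (hp : p ∈ Ideal.span (Set.range F))
    (hpJ : p ∈ restrictSupport A Jᶜ) : p = 0 := by
  obtain ⟨d, hd⟩ := exists_mem_multiples (m := m) hp
  clear hp
  induction d using WellFoundedLT.induction with
  | ind d ih =>
  suffices h : p ∈ multiples m F (· < d) by
    rcases eq_zero_or_of_mem_multiples_lt h with h | ⟨d', hd', h⟩
    · exact h
    · exact ih d' hd' h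
  -- Only one multiple is left on top, with coefficient `a`. Its leading exponent is in `J`, where
  -- `p` has no term, so `a = 0` and the bound `d` drops.
  rcases mem_multiples_le hS hd with h | ⟨α, γ, a, rfl, h⟩
  · exact h
  have hlow : multiples m F (· < m.toSyn (γ + α.1)) ≤
      restrictSupport A {μ | m.toSyn μ < m.toSyn (γ + α.1)} := by
    refine Submodule.span_le.mpr ?_
    rintro _ ⟨β, δ, hlt, rfl⟩
    exact restrictSupport_mono _ (fun μ hμ => lt_of_le_of_lt hμ hlt)
      (monomial_mul_mem_of_isMonicAt hT (hF β) 1)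
  have h0 : coeff (γ + α.1) (p - a • (monomial γ 1 * F α)) = 0 := by
    by_contra hne
    exact lt_irrefl _ (mem_restrictSupport_iff_coeff.mp (hlow h) _ hne)
  have h1 : coeff (γ + α.1) p = 0 := by
    by_contra hne
    exact mem_restrictSupport_iff_coeff.mp hpJ _ hne (hJ α γ)
  have h2 : coeff α.1 (F α) = 1 := by
    have : coeff α.1 (F α - monomial α.1 1) = 0 := by
      by_contra hne
      exact T.irrefl _ (mem_restrictSupport_iff_coeff.mp (hF α) _ hne)
    classical
    rw [coeff_sub, sub_eq_zero] at this
    rw [this, coeff_monomial, if_pos rfl]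
  rw [coeff_sub, h1, coeff_smul, coeff_monomial_mul, h2] at h0
  have ha : a = 0 := by simpa using h0
  simpa [ha] using h

end Buchberger

/-! ### The functor of points of the stratum -/

noncomputable section Stratum

variable {σ : Type} {k : Type u} [Field k] {m : MonomialOrder.{0, w} σ}
  {J : Ideal (MvPolynomial σ k)} {T : TailOrder σ} {A : Type u} [CommRing A]

noncomputable instance (α : σ →₀ ℕ) : Fintype ↑(T.low α ∩ (monomialsIn J)ᶜ) :=
  ((T.finite α).subset Set.inter_subset_left).fintype

theorem isReducedAt_monomial_add_polyOf {α : σ →₀ ℕ}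
    (v : ↑(T.low α ∩ (monomialsIn J)ᶜ) → A) :
    IsReducedAt T (monomialsIn J) α (monomial α 1 + polyOf v) := by
  rw [IsReducedAt, add_sub_cancel_left]
  exact polyOf_mem v

theorem genericPoly_eq (α : basis J) : genericPoly J T.low α = monomial α.1 1 +
    polyOf (s := T.low α.1 ∩ (monomialsIn J)ᶜ) fun β => X ⟨α, β⟩ := by
  let _ : Fintype (TailMod J T.low α.1) :=
    inferInstanceAs (Fintype ↑(T.low α.1 ∩ (monomialsIn J)ᶜ))
  rw [genericPoly, polyOf]
  congr 1
  exact finsum_eq_sum_of_fintype _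

theorem map_genericPoly (θ : ParamRing J T.low →+* A) (α : basis J) :
    map θ (genericPoly J T.low α) = monomial α.1 1 +
      polyOf (s := T.low α.1 ∩ (monomialsIn J)ᶜ) fun β => θ (X ⟨α, β⟩) := by
  rw [genericPoly_eq, map_add, map_monomial, map_one, map_polyOf]
  rfl

theorem isReducedAt_map_genericPoly (θ : ParamRing J T.low →+* A) (α : basis J) :
    IsReducedAt T (monomialsIn J) α.1 (map θ (genericPoly J T.low α)) := by
  rw [map_genericPoly]
  exact isReducedAt_monomial_add_polyOf _

theorem isMonicAt_genericPoly (α : basis J) : IsMonicAt T α.1 (genericPoly J T.low α) := by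
  rw [genericPoly_eq]
  exact (isReducedAt_monomial_add_polyOf _).isMonicAt

theorem IsReducedAt.map {R S : Type*} [CommRing R] [CommRing S] (h : R →+* S) {α : σ →₀ ℕ}
    {K : Set (σ →₀ ℕ)} {f : MvPolynomial σ R} (hf : IsReducedAt T K α f) :
    IsReducedAt T K α (MvPolynomial.map h f) := by
  rw [IsReducedAt, mem_restrictSupport_iff_coeff] at hf ⊢
  intro β hβ
  apply hf
  intro h0
  apply hβ
  rw [← map_one h, ← map_monomial, ← map_sub, coeff_map, h0, map_zero]

theorem mem_monomialsIn_basis (α : basis J) (γ : σ →₀ ℕ) : γ + α.1 ∈ monomialsIn J :=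
  mem_monomialsIn_of_le α.2.prop le_add_self

theorem exists_monic_of_basis [Finite σ] {F : basis J → MvPolynomial σ A}
    (hF : ∀ α, IsMonicAt T α.1 (F α)) :
    ∀ α ∈ monomialsIn J, ∃ G ∈ Ideal.span (Set.range F), IsMonicAt T α G := by
  intro μ hμ
  obtain ⟨α, hαμ, hα⟩ := exists_minimal_le_of_wellFoundedLT (· ∈ monomialsIn J) _ hμ
  obtain ⟨γ, rfl⟩ := le_iff_exists_add'.mp hαμ
  exact ⟨monomial γ 1 * F ⟨α, hα⟩, Ideal.mul_mem_left _ _ (Ideal.subset_span ⟨_, rfl⟩),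
    (isMonicAt_monomial γ).mul (hF ⟨α, hα⟩)⟩

variable (J T) in
/-- The ideal generated by the polynomials `F_α` with parameters specialized by `θ`. -/
def specIdeal (θ : ParamRing J T.low →+* A) : Ideal (MvPolynomial σ A) :=
  Ideal.span (Set.range fun α => map θ (genericPoly J T.low α))

theorem map_sub_mem_of_reductionStep (θ : ParamRing J T.low →+* A)
    {f g : MvPolynomial σ (ParamRing J T.low)}
    (h : Relation.ReflTransGen (ReductionStep J T.low) f g) :
    map θ f - map θ g ∈ specIdeal J T θ := by
  induction h with
  | refl => simp
  | tail _ hstep ih =>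
    obtain ⟨α, γ, δ, -, rfl⟩ := hstep
    rw [map_sub, map_mul, ← sub_add]
    exact add_mem ih (Ideal.mul_mem_left _ _ (Ideal.subset_span ⟨α, rfl⟩))

theorem map_sPoly (θ : ParamRing J T.low →+* A) (α β : basis J) :
    map θ (sPoly J T.low α β) =
      monomial (α.1 ⊔ β.1 - α.1) 1 * map θ (genericPoly J T.low α) -
        monomial (α.1 ⊔ β.1 - β.1) 1 * map θ (genericPoly J T.low β) := by
  simp only [sPoly, map_sub, map_mul, map_monomial, map_one]

/-- Each specialized `H α β` lies in the specialized ideal, as the `S`-polynomial and all reduction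
steps do, and is supported outside `J`; so it vanishes. -/
theorem eq_zero_of_mem_stratumIdeal {θ : ParamRing J T.low →+* A}
    (hθ : HasInitial T (monomialsIn J) (specIdeal J T θ))
    {H : basis J → basis J → MvPolynomial σ (ParamRing J T.low)}
    (hH : IsReductionFamily m J T.low H) : stratumIdeal m J T.low H ≤ RingHom.ker θ := by
  rw [stratumIdeal, Ideal.span_le]
  rintro _ ⟨α, β, hlt, μ, rfl⟩
  obtain ⟨h1, h2⟩ := hH α β hlt
  have h3 : map θ (sPoly J T.low α β) ∈ specIdeal J T θ := by
    rw [map_sPoly]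
    exact sub_mem (Ideal.mul_mem_left _ _ (Ideal.subset_span ⟨α, rfl⟩))
      (Ideal.mul_mem_left _ _ (Ideal.subset_span ⟨β, rfl⟩))
  have h4 : map θ (H α β) = 0 := by
    refine hθ.eq_zero _ (by simpa using sub_mem h3 (map_sub_mem_of_reductionStep θ h1)) ?_
    rw [mem_restrictSupport_iff_coeff]
    intro ν hν
    refine h2 ν (mem_support_iff.mpr fun h0 => hν ?_)
    rw [coeff_map, h0, map_zero]
  change θ _ = 0
  rw [← coeff_map, h4, coeff_zero]

/-- A reduction step only cancels a term already present, so it never uses a multiple with leading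
exponent `d` or more. This is the form of reduction to zero that Buchberger's criterion requires. -/
theorem map_sub_mem_multiples_of_reductionStep (hT : ∀ α, T.low α ⊆ tail m α)
    (θ : ParamRing J T.low →+* A) {d : m.syn} {f g : MvPolynomial σ (ParamRing J T.low)}
    (h : Relation.ReflTransGen (ReductionStep J T.low) f g)
    (hf : f ∈ restrictSupport _ {μ | m.toSyn μ < d}) :
    g ∈ restrictSupport _ {μ | m.toSyn μ < d} ∧ map θ f - map θ g ∈
      multiples m (fun α => map θ (genericPoly J T.low α)) (· < d) := by
  induction h with
  | refl => simpa using hf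
  | @tail g g' _ hstep ih =>
    obtain ⟨ih1, ih2⟩ := ih
    obtain ⟨α, γ, δ, hne, rfl⟩ := hstep
    have hlt : m.toSyn (γ + α.1) < d :=
      mem_restrictSupport_iff_coeff.mp ih1 _ fun h0 => hne (by rw [h0, coeff_zero])
    refine ⟨sub_mem ih1 ?_, ?_⟩
    · exact restrictSupport_mono _ (fun μ hμ => lt_of_le_of_lt hμ hlt)
        (monomial_mul_mem_of_isMonicAt hT (isMonicAt_genericPoly α) _)
    · rw [map_sub, map_mul, ← sub_add, map_monomial]
      refine add_mem ih2 ?_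
      generalize θ _ = a
      rw [show monomial γ a = a • monomial γ (1 : A) by simp [smul_monomial], smul_mul_assoc]
      exact Submodule.smul_mem _ _ (mem_multiples hlt)

theorem sPoly_mem (hT : ∀ α, T.low α ⊆ tail m α) (α β : basis J) : sPoly J T.low α β ∈
    restrictSupport (ParamRing J T.low) {μ | m.toSyn μ < m.toSyn (α.1 ⊔ β.1)} := by
  have h1 : ∀ (α : basis J) (μ : σ →₀ ℕ), α.1 ≤ μ →
      monomial (μ - α.1) 1 * genericPoly J T.low α - monomial μ 1 ∈
        restrictSupport (ParamRing J T.low) {ν | m.toSyn ν < m.toSyn μ} := by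
    intro α μ hα
    have h2 := (isMonicAt_monomial (μ - α.1)).mul (isMonicAt_genericPoly (T := T) α)
    rw [tsub_add_cancel_of_le hα] at h2
    exact restrictSupport_mono _ (hT μ) h2
  have := sub_mem (h1 α _ (le_sup_left : α.1 ≤ α.1 ⊔ β.1))
    (h1 β _ (le_sup_right : β.1 ≤ α.1 ⊔ β.1))
  rwa [sub_sub_sub_cancel_right] at this

theorem hasInitial_specIdeal [Finite σ] (hT : ∀ α, T.low α ⊆ tail m α)
    {H : basis J → basis J → MvPolynomial σ (ParamRing J T.low)}
    (hH : IsReductionFamily m J T.low H) {θ : ParamRing J T.low →+* A}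
    (hθ : stratumIdeal m J T.low H ≤ RingHom.ker θ) :
    HasInitial T (monomialsIn J) (specIdeal J T θ) := by
  have hmon : ∀ α : basis J, IsMonicAt T α.1 (map θ (genericPoly J T.low α)) := fun α =>
    (isReducedAt_map_genericPoly θ α).isMonicAt
  refine ⟨exists_monic_of_basis hmon, fun f hf hfJ => ?_⟩
  refine eq_zero_of_sPoly hT hmon ?_ mem_monomialsIn_basis hf hfJ
  have key : ∀ α β : basis J, m.toSyn α.1 < m.toSyn β.1 →
      map θ (sPoly J T.low α β) ∈ multiples m (fun α => map θ (genericPoly J T.low α))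
        (· < m.toSyn (α.1 ⊔ β.1)) := by
    intro α β hlt
    have h0 : map θ (H α β) = 0 := by
      ext μ
      rw [coeff_map, coeff_zero]
      exact hθ (Ideal.subset_span ⟨α, β, hlt, μ, rfl⟩)
    have := (map_sub_mem_multiples_of_reductionStep hT θ (hH α β hlt).1 (sPoly_mem hT α β)).2
    rwa [h0, sub_zero] at this
  intro α β
  rcases lt_trichotomy (m.toSyn α.1) (m.toSyn β.1) with h | h | h
  · rw [← map_sPoly]
    exact key α β h
  · rw [Subtype.ext (m.toSyn.injective h), sub_self]
    exact zero_mem _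
  · rw [← neg_sub, sup_comm, ← map_sPoly]
    exact neg_mem (key β α h)

/-- The coordinate ring of the stratum is a polynomial ring, if the ideals with initial ideal `J`
are parametrized by an affine space. -/
theorem nonempty_algEquiv [Finite σ] (hT : ∀ α, T.low α ⊆ tail m α)
    {H : basis J → basis J → MvPolynomial σ (ParamRing J T.low)}
    (hH : IsReductionFamily m J T.low H) (P : Parametrization.{u} T (monomialsIn J)) :
    Nonempty ((ParamRing J T.low ⧸ stratumIdeal m J T.low H) ≃ₐ[k] MvPolynomial P.index k) := by
  -- The universal ideal, whose parameters are indeterminates. The coefficients of its reduced basis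
  -- define `θ`, hence the map `φ` out of the coordinate ring.
  set I₀ : Ideal (MvPolynomial σ (MvPolynomial P.index k)) := P.toIdeal X with hI₀
  have hI₀i : HasInitial T (monomialsIn J) I₀ := P.hasInitial _
  choose F hFI hF using fun α : basis J => hI₀i.exists_isReducedAt α.2.prop
  set θ : ParamRing J T.low →ₐ[k] MvPolynomial P.index k :=
    aeval fun c => coeff c.2.1 (F c.1) with hθ
  have hθF : ∀ α, map (θ : ParamRing J T.low →+* MvPolynomial P.index k) (genericPoly J T.low α) = F α := by
    intro α
    obtain ⟨v, hv⟩ := exists_polyOf (hF α)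
    rw [map_genericPoly, eq_comm, ← sub_eq_iff_eq_add', ← hv]
    congr 1
    funext β
    have h1 : coeff β.1 (polyOf v) = coeff β.1 (F α) := by
      classical
      rw [hv, coeff_sub, coeff_monomial, if_neg, sub_zero]
      intro h
      exact β.2.2 (h ▸ α.2.prop)
    rw [← coeff_polyOf v, h1]
    simp [hθ]
  have hspec : specIdeal J T (θ : ParamRing J T.low →+* MvPolynomial P.index k) = I₀ := by
    have h1 : specIdeal J T (θ : ParamRing J T.low →+* MvPolynomial P.index k) = Ideal.span (Set.range F) := by
      rw [specIdeal]
      simp only [hθF]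
    rw [h1]
    refine hI₀i.eq_of_le (exists_monic_of_basis fun α => (hF α).isMonicAt) ?_
    rw [Ideal.span_le]
    rintro _ ⟨α, rfl⟩
    exact hFI α
  have hker : stratumIdeal m J T.low H ≤ RingHom.ker (θ : ParamRing J T.low →+* MvPolynomial P.index k) :=
    eq_zero_of_mem_stratumIdeal (by rwa [hspec]) hH
  set φ : (ParamRing J T.low ⧸ stratumIdeal m J T.low H) →ₐ[k] MvPolynomial P.index k :=
    Ideal.Quotient.liftₐ _ θ fun a ha => hker ha with hφ
  set π := Ideal.Quotient.mk (stratumIdeal m J T.low H) with hπ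
  have hI₁i : HasInitial T (monomialsIn J) (specIdeal J T π) :=
    hasInitial_specIdeal hT hH (by rw [hπ, Ideal.mk_ker])
  -- The parameters of the tautological ideal over the coordinate ring of the stratum define the
  -- inverse `ψ`.
  obtain ⟨v, hv⟩ := P.surjective _ hI₁i
  set ψ : MvPolynomial P.index k →ₐ[k] (ParamRing J T.low ⧸ stratumIdeal m J T.low H) :=
    aeval v with hψ
  refine ⟨AlgEquiv.ofAlgHom φ ψ ?_ ?_⟩
  -- `φ` carries the tautological ideal to `I₀`, so injectivity of the parametrization identifies
  -- the parameters.
  · apply MvPolynomial.algHom_ext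
    intro i
    suffices h : (φ : _ →+* MvPolynomial P.index k) ∘ v = X from by simpa [hψ] using congrFun h i
    apply P.injective
    rw [← P.map_toIdeal, hv, ← hI₀, ← hspec, specIdeal, specIdeal, Ideal.map_span]
    congr 1
    rw [← Set.range_comp]
    congr 1
    funext α
    rw [Function.comp_apply, map_map]
    congr 1
  -- `ψ` carries `I₀` to the tautological ideal, and uniqueness of reduced elements identifies the
  -- coefficients.
  · apply Ideal.Quotient.algHom_ext
    apply MvPolynomial.algHom_ext
    rintro ⟨α, β⟩
    have h1 : map (ψ : MvPolynomial P.index k →+*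
        ParamRing J T.low ⧸ stratumIdeal m J T.low H) (F α) = map π (genericPoly J T.low α) := by
      refine hI₁i.eq_of_isReducedAt ?_ (Ideal.subset_span ⟨α, rfl⟩) ((hF α).map _)
        (isReducedAt_map_genericPoly π α)
      have h2 := Ideal.mem_map_of_mem (map (ψ : MvPolynomial P.index k →+*
        ParamRing J T.low ⧸ stratumIdeal m J T.low H)) (hFI α)
      have h3 : (ψ : MvPolynomial P.index k →+*
          ParamRing J T.low ⧸ stratumIdeal m J T.low H) ∘ X = v := by
        funext i
        rw [Function.comp_apply, RingHom.coe_coe, hψ, aeval_X]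
      have h4 := P.map_toIdeal (ψ : MvPolynomial P.index k →+*
          ParamRing J T.low ⧸ stratumIdeal m J T.low H) X
      rw [h3, hv] at h4
      rw [← h4]
      exact h2
    have h2 : coeff β.1 (map π (genericPoly J T.low α)) = π (X ⟨α, β⟩) := by
      classical
      rw [map_genericPoly, coeff_add, coeff_monomial, if_neg, zero_add]
      · exact coeff_polyOf (s := T.low α.1 ∩ (monomialsIn J)ᶜ) (fun β => π (X ⟨α, β⟩)) β
      · intro h
        exact β.2.2 (h ▸ α.2.prop)
    rw [← h1, coeff_map] at h2
    change ψ (φ (π (X ⟨α, β⟩))) = π (X ⟨α, β⟩)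
    rw [show φ (π (X ⟨α, β⟩)) = coeff β.1 (F α) from aeval_X _ _]
    exact h2

theorem isAffineStratum_of_parametrization [Finite σ] (hT : ∀ α, T.low α ⊆ tail m α)
    (P : Parametrization.{u} T (monomialsIn J)) : IsAffineStratum m J T.low := by
  have := P.finite
  refine ⟨Nat.card P.index, fun H hH => ?_⟩
  obtain ⟨E⟩ := nonempty_algEquiv hT hH P
  set E' := E.trans (renameEquiv k ((Finite.equivFin P.index).trans
    Equiv.ulift.{u}.symm)) with hE'
  refine ⟨Over.isoMk (Scheme.Spec.mapIso E'.symm.toRingEquiv.toCommRingCatIso.op ≪≫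
    (AffineSpace.SpecIso _ (CommRingCat.of k)).symm) ?_⟩
  simp only [affineSpace, stratum, Over.mk_hom, Iso.trans_hom, Iso.symm_hom, Category.assoc,
    AffineSpace.SpecIso_inv_over, Functor.mapIso_hom, Iso.op_hom, Scheme.Spec_map]
  rw [← Spec.map_comp]
  congr 1
  ext x
  exact E'.symm.commutes x

end Stratum

end Strata

/-! ### Tails and homogeneous tails as instances -/

namespace Strata

open MvPolynomial

universe u w

noncomputable section Final

variable {n : ℕ} {k : Type u} [Field k] (m : MonomialOrder.{0, w} (Fin (n + 1)))

/-- The tails of a reliable term order. -/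
def tailOrder (h : Reliable m) : TailOrder (Fin (n + 1)) where
  lt β α := m.toSyn β < m.toSyn α
  irrefl _ := lt_irrefl _
  trans := lt_trans
  add_iff γ := by simp
  finite := h

theorem finite_htail {σ : Type} [Finite σ] (m : MonomialOrder.{0, w} σ) (α : σ →₀ ℕ) :
    (htail m α).Finite :=
  (Finsupp.finite_of_degree_le α.degree).subset fun _ h => h.2.le

/-- The homogeneous tails of a term order. -/
def htailOrder : TailOrder (Fin (n + 1)) where
  lt β α := m.toSyn β < m.toSyn α ∧ β.degree = α.degree
  irrefl _ h := lt_irrefl _ h.1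
  trans h h' := ⟨h.1.trans h'.1, h.2.trans h'.2⟩
  add_iff γ := by simp
  finite := finite_htail m

variable {m}

theorem isAffineStratum_of_forall {J : Ideal (MvPolynomial (Fin (n + 1)) k)}
    (h : ∀ T : TailOrder (Fin (n + 1)), Nonempty (Parametrization.{u} T (monomialsIn J))) :
    HomogeneousStratumIsAffineSpace m J ∧ (Reliable m → StratumIsAffineSpace m J) :=
  ⟨isAffineStratum_of_parametrization (T := htailOrder m) (fun _ _ h => h.1) (h _).some,
    fun hm => isAffineStratum_of_parametrization (T := tailOrder m hm) (fun _ _ h => h)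
      (h _).some⟩

theorem isAffineStratum_of_lexSet {J : Ideal (MvPolynomial (Fin (n + 1)) k)} {r : ℕ}
    {p : Fin r → Fin (n + 1)} (hp : Function.Injective p) {b : Fin r → ℕ}
    (hJ : monomialsIn J = lexSet p b) :
    HomogeneousStratumIsAffineSpace m J ∧ (Reliable m → StratumIsAffineSpace m J) :=
  isAffineStratum_of_forall fun T => hJ ▸ (exists_parametrization_lexSet T hp b).2.2

end Final

/-! ### Saturated lex-segment ideals -/

section LexSegment

variable {n : ℕ} {k : Type u} [Field k] {J : Ideal (MvPolynomial (Fin (n + 1)) k)}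

theorem single_add_mem_of_isLexSegment (hJ : IsLexSegment J) {μ : Fin (n + 1) →₀ ℕ}
    (h : Finsupp.single (Fin.last n) 1 + μ ∈ monomialsIn J) (i : Fin (n + 1)) :
    Finsupp.single i 1 + μ ∈ monomialsIn J := by
  rcases eq_or_ne i (Fin.last n) with rfl | hi
  · exact h
  refine hJ.2 _ _ (by simp) ?_ h
  refine ⟨i, fun j hj => ?_, ?_⟩
  · have h1 : j ≠ Fin.last n := (hj.trans_le (Fin.le_last i)).ne
    simp [h1.symm, hj.ne']
  · simp [hi.symm]

/-- Replacing `x_n` by another variable raises a monomial for `Lex`, so `x_n X^μ ∈ J` puts every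
`x_i X^μ` in `J`; saturation then applies with exponent `1`. -/
theorem mem_of_single_last_add_mem (hJ : IsLexSegment J) (hs : IsSaturated J)
    {μ : Fin (n + 1) →₀ ℕ} (h : Finsupp.single (Fin.last n) 1 + μ ∈ monomialsIn J) :
    μ ∈ monomialsIn J := by
  refine hs _ ⟨1, fun g hg => ?_⟩
  rw [pow_one] at hg
  induction hg using Submodule.span_induction with
  | mem x hx =>
    obtain ⟨i, rfl⟩ := hx
    have := single_add_mem_of_isLexSegment hJ h i
    simpa [monomialsIn, X, monomial_mul] using this
  | zero => simp
  | add x y _ _ hx hy => rw [add_mul]; exact add_mem hx hy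
  | smul a x _ hx => rw [smul_mul_assoc]; exact Submodule.smul_mem _ _ hx

theorem mem_iff_single_last_add_mem (hJ : IsLexSegment J) (hs : IsSaturated J)
    {μ : Fin (n + 1) →₀ ℕ} (c : ℕ) :
    Finsupp.single (Fin.last n) c + μ ∈ monomialsIn J ↔ μ ∈ monomialsIn J := by
  refine ⟨fun h => ?_, fun h => mem_monomialsIn_of_le h le_add_self⟩
  induction c with
  | zero => simpa using h
  | succ c ih =>
    refine ih (mem_of_single_last_add_mem hJ hs ?_)
    rwa [← add_assoc, ← Finsupp.single_add, add_comm 1]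

/-- The monomials of a saturated lex-segment ideal form an up-set for the lexicographic order of
their exponents at all variables but the last one. -/
theorem mem_of_toLex_le (hJ : IsLexSegment J) (hs : IsSaturated J) {μ ν : Fin (n + 1) →₀ ℕ}
    (h : (toLex fun j : Fin n => μ j.castSucc) ≤ toLex fun j : Fin n => ν j.castSucc)
    (hμ : μ ∈ monomialsIn J) : ν ∈ monomialsIn J := by
  -- Each monomial is multiplied by `x_n` to the degree of the other: the degrees become equal and
  -- the first `n` exponents are untouched.
  rw [← mem_iff_single_last_add_mem hJ hs μ.degree]
  rw [← mem_iff_single_last_add_mem hJ hs ν.degree] at hμ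
  set μ' := Finsupp.single (Fin.last n) ν.degree + μ with hμ'
  set ν' := Finsupp.single (Fin.last n) μ.degree + ν with hν'
  have hdeg : μ'.degree = ν'.degree := by simp [hμ', hν', add_comm]
  have hμj : ∀ j : Fin n, μ' j.castSucc = μ j.castSucc := fun j => by
    simp [hμ']
  have hνj : ∀ j : Fin n, ν' j.castSucc = ν j.castSucc := fun j => by
    simp [hν']
  rcases h.lt_or_eq with hlt | heq
  · obtain ⟨i, hi, hi'⟩ := hlt
    refine hJ.2 μ' ν' hdeg ⟨i.castSucc, fun j hj => ?_, ?_⟩ hμ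
    · obtain ⟨j, rfl⟩ := Fin.eq_castSucc_of_ne_last (hj.trans_le (Fin.le_last _)).ne
      have := hi j (by simpa using hj)
      change μ' j.castSucc = ν' j.castSucc
      rw [hμj, hνj]
      exact this
    · change μ' i.castSucc < ν' i.castSucc
      rw [hμj, hνj]
      exact hi'
  · have heq' : ∀ j : Fin n, μ' j.castSucc = ν' j.castSucc := fun j => by
      rw [hμj, hνj]
      exact congrFun (toLex.injective heq) j
    have : μ' = ν' := by
      ext j
      refine Fin.lastCases ?_ heq' j
      rw [Finsupp.degree_eq_sum, Finsupp.degree_eq_sum, Fin.sum_univ_castSucc,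
        Fin.sum_univ_castSucc, Finset.sum_congr rfl fun j _ => heq' j] at hdeg
      exact add_left_cancel hdeg
    rwa [← this]

/-- The lexicographic order on `Fin n → ℕ` is a well-order, so `b` can be the least exponent vector
that occurs. The empty alternative is the zero ideal. -/
theorem monomialsIn_lexSegment (hJ : IsLexSegment J) (hs : IsSaturated J) :
    monomialsIn J = ∅ ∨ ∃ b : Fin n → ℕ, monomialsIn J = lexSet Fin.castSucc b := by
  rcases Set.eq_empty_or_nonempty (monomialsIn J) with h | ⟨μ₀, hμ₀⟩
  · exact Or.inl h
  right
  let S : Set (Lex (Fin n → ℕ)) :=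
    (fun μ : Fin (n + 1) →₀ ℕ => toLex fun j : Fin n => μ j.castSucc) '' monomialsIn J
  obtain ⟨_, ⟨μ, hμ, rfl⟩, hmin⟩ := WellFounded.has_min
    (wellFounded_lt : WellFounded (α := Lex (Fin n → ℕ)) (· < ·)) S ⟨_, μ₀, hμ₀, rfl⟩
  refine ⟨fun j => μ j.castSucc, Set.ext fun ν => ⟨fun hν => ?_, fun hν => ?_⟩⟩
  · exact not_lt.mp (hmin _ ⟨ν, hν, rfl⟩)
  · exact mem_of_toLex_le hJ hs hν hμ

end LexSegment

/-! ### The monomials of `J(a_q, …, a_1)` -/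

section LexIdeal

variable {n q : ℕ} {k : Type u} [Field k]

variable (n) in
/-- The index of the variable `x_{n-j}`. -/
def backIndex (j : ℕ) : Fin (n + 1) := ⟨n - j, by omega⟩

theorem backIndex_injOn (hq : q ≤ n) {i j : ℕ} (hi : i ≤ q) (hj : j ≤ q)
    (h : backIndex n i = backIndex n j) : i = j := by
  simp only [backIndex, Fin.mk.injEq] at h
  omega

theorem tailProd_eq (a : ℕ → ℕ) (i : ℕ) : tailProd k n q a i =
    monomial (∑ j ∈ Finset.Icc i q, Finsupp.single (backIndex n j) (a j)) 1 := by
  rw [monomial_sum_one]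
  exact Finset.prod_congr rfl fun j _ => X_pow_eq_monomial

theorem xBack_mul_tailProd (a : ℕ → ℕ) {i : ℕ} (hi : i ≤ q) : xBack k n i * tailProd k n q a i =
    tailProd k n q (Function.update a i (a i + 1)) i := by
  rw [tailProd, tailProd, Finset.Icc_eq_cons_Ioc hi, Finset.prod_cons, Finset.prod_cons,
    Function.update_self, pow_succ', mul_assoc]
  congr 2
  refine Finset.prod_congr rfl fun j hj => ?_
  rw [Function.update_of_ne (Finset.mem_Ioc.mp hj).1.ne']

theorem sum_single_le_iff (hq : q ≤ n) (a : ℕ → ℕ) (i : ℕ) (μ : Fin (n + 1) →₀ ℕ) :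
    ∑ j ∈ Finset.Icc i q, Finsupp.single (backIndex n j) (a j) ≤ μ ↔
      ∀ j, i ≤ j → j ≤ q → a j ≤ μ (backIndex n j) := by
  classical
  have h : ∀ j, i ≤ j → j ≤ q → (∑ j ∈ Finset.Icc i q, Finsupp.single (backIndex n j) (a j))
      (backIndex n j) = a j := by
    intro j hij hjq
    rw [Finsupp.finsetSum_apply, Finset.sum_eq_single j]
    · simp
    · intro l hl hlj
      rw [Finsupp.single_apply, if_neg]
      exact fun h => hlj (backIndex_injOn hq (Finset.mem_Icc.mp hl).2 hjq h)
    · intro hj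
      exact absurd (Finset.mem_Icc.mpr ⟨hij, hjq⟩) hj
  constructor
  · intro hle j hij hjq
    exact (h j hij hjq).symm.le.trans (hle _)
  · intro hle x
    by_cases hx : ∃ j, i ≤ j ∧ j ≤ q ∧ backIndex n j = x
    · obtain ⟨j, hij, hjq, rfl⟩ := hx
      rw [h j hij hjq]
      exact hle j hij hjq
    · rw [Finsupp.finsetSum_apply, Finset.sum_eq_zero]
      · exact zero_le
      · intro j hj
        rw [Finsupp.single_apply, if_neg]
        exact fun h => hx ⟨j, (Finset.mem_Icc.mp hj).1, (Finset.mem_Icc.mp hj).2, h⟩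

theorem mem_monomialsIn_lexIdeal (hq : q ≤ n) (a : ℕ → ℕ) (μ : Fin (n + 1) →₀ ℕ) :
    μ ∈ monomialsIn (lexIdeal k n q a) ↔
      (∃ i, firstIndex a + 2 ≤ i ∧ i ≤ q ∧ ∀ j, i ≤ j → j ≤ q →
        Function.update a i (a i + 1) j ≤ μ (backIndex n j)) ∨
      ∀ j, firstIndex a + 1 ≤ j → j ≤ q → a j ≤ μ (backIndex n j) := by
  have h : lexIdeal k n q a = Ideal.span ((fun s => monomial s (1 : k)) ''
      ({ν | ∃ i, firstIndex a + 2 ≤ i ∧ i ≤ q ∧ ν = ∑ j ∈ Finset.Icc i q,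
        Finsupp.single (backIndex n j) (Function.update a i (a i + 1) j)} ∪
      {∑ j ∈ Finset.Icc (firstIndex a + 1) q, Finsupp.single (backIndex n j) (a j)})) := by
    rw [lexIdeal, Set.image_union, Set.image_singleton, ← tailProd_eq]
    congr 2
    ext f
    constructor
    · rintro ⟨i, hi, hiq, rfl⟩
      exact ⟨_, ⟨i, hi, hiq, rfl⟩, by rw [xBack_mul_tailProd a hiq, tailProd_eq]⟩
    · rintro ⟨_, ⟨i, hi, hiq, rfl⟩, rfl⟩
      exact ⟨i, hi, hiq, by rw [xBack_mul_tailProd a hiq, tailProd_eq]⟩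
  change monomial μ (1 : k) ∈ lexIdeal k n q a ↔ _
  classical
  rw [h, mem_ideal_span_monomial_image, support_monomial, if_neg one_ne_zero]
  simp only [Finset.mem_singleton, forall_eq, Set.mem_union, Set.mem_singleton_iff, or_and_right,
    exists_or, exists_eq_left, sum_single_le_iff hq]
  refine or_congr_left ⟨?_, ?_⟩
  · rintro ⟨_, ⟨i, hi, hiq, rfl⟩, hle⟩
    exact ⟨i, hi, hiq, (sum_single_le_iff hq _ _ _).mp hle⟩
  · rintro ⟨i, hi, hiq, hle⟩
    exact ⟨_, ⟨i, hi, hiq, rfl⟩, (sum_single_le_iff hq _ _ _).mpr hle⟩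

/-- The variables are read in the order `x_{n-q}, …, x_{n-1}`. The generator of index `i` covers the
exponents that agree with `a` before position `i` and exceed it there. The last generator covers
equality and a first excess at an index at most `s + 1`, because `a_1, …, a_s` vanish. -/
theorem monomialsIn_lexIdeal (hq : q ≤ n) {a : ℕ → ℕ} (ha : ∃ i, 1 ≤ i ∧ i ≤ q ∧ a i ≠ 0) :
    monomialsIn (lexIdeal k n q a) =
      lexSet (fun j : Fin q => backIndex n (q - j)) fun j : Fin q => a (q - j) := by
  obtain ⟨i₀, hi₀, hi₀q, hai₀⟩ := ha
  have hne : ({s | a (s + 1) ≠ 0} : Set ℕ).Nonempty := ⟨i₀ - 1, by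
    rwa [Set.mem_ofPred_eq, Nat.sub_add_cancel hi₀]⟩
  have hs : a (firstIndex a + 1) ≠ 0 := Nat.sInf_mem hne
  have hs0 : ∀ t, 1 ≤ t → t ≤ firstIndex a → a t = 0 := by
    intro t ht hts
    by_contra h
    have : firstIndex a ≤ t - 1 := Nat.sInf_le (by
      rwa [Set.mem_ofPred_eq, Nat.sub_add_cancel ht])
    omega
  have hsq : firstIndex a + 1 ≤ q := by
    by_contra h
    exact hai₀ (hs0 i₀ hi₀ (by omega))
  ext μ
  rw [mem_monomialsIn_lexIdeal hq]
  constructor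
  · intro h
    change (toLex fun j : Fin q => a (q - j)) ≤ toLex fun j : Fin q => μ (backIndex n (q - j))
    refine not_lt.mp ?_
    rintro ⟨j, hj, hlt⟩
    obtain ⟨t, ht⟩ : ∃ t, t = q - (j : ℕ) := ⟨_, rfl⟩
    have hjq := j.2
    change μ (backIndex n (q - j)) < a (q - j) at hlt
    rw [← ht] at hlt
    have hu : ∀ u, t < u → u ≤ q → μ (backIndex n u) = a u := by
      intro u htu huq
      have := hj ⟨q - u, by omega⟩ (Fin.lt_def.mpr (by simp only; omega))
      change μ (backIndex n (q - (q - u))) = a (q - (q - u)) at this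
      rwa [Nat.sub_sub_self huq] at this
    rcases h with ⟨i, hi, hiq, h⟩ | h
    · have h1 := h i le_rfl hiq
      rw [Function.update_self] at h1
      rcases lt_trichotomy t i with hti | rfl | hti
      · have := hu i hti hiq
        omega
      · omega
      · have h2 := h t hti.le (by omega)
        rw [Function.update_of_ne hti.ne'] at h2
        omega
    · by_cases hts : firstIndex a + 1 ≤ t
      · have := h t hts (by omega)
        omega
      -- Here `t ≤ s`, so `a t = 0` and no exponent can be smaller.
      · have := hs0 t (by omega) (by omega)
        omega
  · intro h
    change (toLex fun j : Fin q => a (q - j)) ≤ toLex fun j : Fin q => μ (backIndex n (q - j)) at h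
    rcases lt_or_eq_of_le h with ⟨j, hj, hlt⟩ | heq
    · obtain ⟨t, ht⟩ : ∃ t, t = q - (j : ℕ) := ⟨_, rfl⟩
      have hjq := j.2
      change a (q - j) < μ (backIndex n (q - j)) at hlt
      rw [← ht] at hlt
      have hu : ∀ u, t < u → u ≤ q → a u = μ (backIndex n u) := by
        intro u htu huq
        have := hj ⟨q - u, by omega⟩ (Fin.lt_def.mpr (by simp only; omega))
        change a (q - (q - u)) = μ (backIndex n (q - (q - u))) at this
        rwa [Nat.sub_sub_self huq] at this
      by_cases hts : firstIndex a + 2 ≤ t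
      · refine Or.inl ⟨t, hts, by omega, fun u htu huq => ?_⟩
        rcases htu.eq_or_lt with rfl | htu
        · rw [Function.update_self]
          exact hlt
        · rw [Function.update_of_ne htu.ne']
          exact (hu u htu huq).le
      -- The first excess occurs at `t ≤ s + 1`, so every index `u ≥ s + 1` is `t` itself or one
      -- where equality holds.
      · refine Or.inr fun u hsu huq => ?_
        rcases (show t ≤ u by omega).eq_or_lt with rfl | htu
        · exact hlt.le
        · exact (hu u htu huq).le
    · refine Or.inr fun u hsu huq => ?_
      have := congrFun (toLex.injective heq) ⟨q - u, by omega⟩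
      change a (q - (q - u)) = μ (backIndex n (q - (q - u))) at this
      rw [Nat.sub_sub_self huq] at this
      exact this.le

end LexIdeal

end Strata

theorem corollary5p4 {k : Type*} [Field k] (n : ℕ) (m : MonomialOrder (Fin (n + 1))) :
    (∀ (q : ℕ) (a : ℕ → ℕ), q ≤ n → (∃ i, 1 ≤ i ∧ i ≤ q ∧ a i ≠ 0) →
      Strata.HomogeneousStratumIsAffineSpace m (Strata.lexIdeal k n q a) ∧
      (Strata.Reliable m → Strata.StratumIsAffineSpace m (Strata.lexIdeal k n q a))) ∧
    (∀ J : Ideal (MvPolynomial (Fin (n + 1)) k), Strata.IsLexSegment J → Strata.IsSaturated J →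
      Strata.HomogeneousStratumIsAffineSpace m J ∧
      (Strata.Reliable m → Strata.StratumIsAffineSpace m J)) := by
  refine ⟨fun q a hq ha => ?_, fun J hJ hs => ?_⟩
  · refine Strata.isAffineStratum_of_lexSet (fun i j hij => ?_)
      (Strata.monomialsIn_lexIdeal (k := k) hq ha)
    have := Strata.backIndex_injOn hq (Nat.sub_le _ _) (Nat.sub_le _ _) hij
    exact Fin.ext (by omega)
  · rcases Strata.monomialsIn_lexSegment hJ hs with h | ⟨b, h⟩
    · exact Strata.isAffineStratum_of_forall fun T => h ▸ ⟨Strata.Parametrization.empty T⟩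
    · exact Strata.isAffineStratum_of_lexSet (Fin.castSucc_injective n) h
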